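/- Let $\eta>0$. Consider the two-periodic zero-sum game with payoff matrices $A_t=\begin{pmatrix}0&1\\1&0\end{pmatrix}$ for odd $t$ and $A_t=\begin{pmatrix}0&-1\\-1&0\end{pmatrix}$ for even $t$, whose equilibrium is $x_1^*=x_2^*=(\tfrac12,\tfrac12)$, and Optimistic Multiplicative Weights Update with step size $\eta$: for $t\ge 0$ and $s\in\{1,2\}$, $$x_{1,s}^{t+1}\propto x_{1,s}^t\,e^{2\eta(A_tx_2^t)_s-\eta(A_{t-1}x_2^{t-1})_s},\qquad x_{2,s}^{t+1}\propto x_{2,s}^t\,e^{-2\eta(A_t^\top x_1^t)_s+\eta(A_{t-1}^\top x_1^{t-1})_s},$$ normalized so that $x_i^{t+1}\in\Delta_2$, where $x_1^{-1},x_2^{-1}\in\Delta_2$ are arbitrary and $x_1^0,x_2^0\in\Delta_2$ have positive entries. Put $z^n=(x_{1,1}^{n-1},x_{1,1}^{n},x_{2,1}^{n-1},x_{2,1}^{n})$ and, with $\sigma(p,q)=\frac{pe^{q}}{pe^{q}+(1-p)e^{-q}}$, let $$G_1(z)=\bigl(z_2,\ \sigma(z_2,\tfrac{3\eta}{2}-2\eta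 z_4-\eta z_3),\ z_4,\ \sigma(z_4,-\tfrac{3\eta}{2}+2\eta z_2+\eta z_1)\bigr),$$ $$G_2(z)=\bigl(z_2,\ \sigma(z_2,-\tfrac{3\eta}{2}+2\eta z_4+\eta z_3),\ z_4,\ \sigma(z_4,\tfrac{3\eta}{2}-2\eta z_2-\eta z_1)\bigr),$$ so that $G_2$ maps $z^n$ to $z^{n+1}$ for even $n\ge0$, and $G_1$ does so for odd $n$. Let $\varphi(a)=\frac{ae^{-3\eta}}{ae^{-3\eta}+1-a}$, and let $\mathrm{KL}(x^*,x^t)=\sum_{i=1}^2\sum_{s=1}^2 x^*_{i,s}\ln(x^*_{i,s}/x^t_{i,s})$. Then $z^{n+2}=(G_1\circ G_2)(z^n)$ for every even $n\ge 0$, and the following holds for each player $i$ and pure strategy $s$, with the family $p_a$ given by $(0,0,a,\varphi(a))$ for $(i,s)=(1,1)$, $(1,1,1-a,1-\varphi(a))$ for $(1,2)$, $(1-a,1-\varphi(a),0,0)$ for $(2,1)$, and $(a,\varphi(a),1,1)$ for $(2,2)$. 1. For every $a\in[0,1]$, $p_a$ is a fixed point of $G_1\circ G_2$. 2. For every $a\in(0,1)$,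 $G_1\circ G_2$ is differentiable at $p_a$ and the eigenvalues of its Jacobian matrix there, with algebraic multiplicity, are $0,0,1,\lambda$ with $\lambda=\exp\bigl(-\frac{2\eta a(1-a)(e^{3\eta}-1)}{a+(1-a)e^{3\eta}}\bigr)\in(0,1)$. 3. For every $\varepsilon>0$ there is $\delta>0$ such that, for every trajectory and every even $n\ge2$, if $x_{i,s}^{n-1},x_{i,s}^{n}<\delta$, then $z^n$ is within $\varepsilon$ of $p_a$ for some $a\in(0,1)$. 4. For every $a\in(0,1)$ there is $\rho>0$ such that for every $z\in[0,1]^4$ within $\rho$ of $p_a$, the two entries of $(G_1\circ G_2)^t(z)$ that belong to player $i$ converge, as $t\to\infty$, to their common value in $p_a$ ($0$ if $s=1$, $1$ if $s=2$). 5. For every $\kappa>0$ there is $\delta>0$ such that, for every trajectory and every $n\ge0$, if $x_{i,s}^{n-1},x_{i,s}^n<\delta$ and both probabilities of the other player at time $n$ are at least $\kappa$, then $x_{i,s}^t\to0$ and $\mathrm{KL}(x^*,x^t)\to\infty$ as $t\to\infty$. 6. There is $\delta>0$ such that, for every trajectory and every $n\ge0$, if $x_{i,s}^{n-1},x_{i,s}^n<\delta$,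 then at least one of the players converges to the boundary ($x_{i,s}^t\to0$, or $x_{j,s'}^t\to0$ for the other player $j$ and some $s'$), and $\mathrm{KL}(x^*,x^t)\to\infty$ as $t\to\infty$. -/

import Mathlib

open Filter Topology Polynomial

noncomputable section

namespace PeriodicOMWU

/-- The two-periodic zero-sum game: the payoff matrix (of the first player, who maximizes) at
time `t`. -/
def payoff (t : ℤ) : Matrix (Fin 2) (Fin 2) ℝ :=
  if Even t then !![0, -1; -1, 0] else !![0, 1; 1, 0]

/-- One multiplicative-weights step: weights `w` are reweighted by `exp (g s)` and normalized. -/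
def mwStep (w g : Fin 2 → ℝ) (s : Fin 2) : ℝ :=
  w s * Real.exp (g s) / ∑ r, w r * Real.exp (g r)

/-- `x t i s` is the probability that player `i` gives to pure strategy `s` at time `t ≥ -1`
(values at times below `-1` are irrelevant).  The sequence is a trajectory of Optimistic
Multiplicative Weights Update with step size `η` in the periodic game; the initial pair consists
of an arbitrary mixed profile at time `-1` and a fully mixed profile at time `0`. -/
structure IsOMWU (η : ℝ) (x : ℤ → Fin 2 → Fin 2 → ℝ) : Prop where
  prev_mem : ∀ i, x (-1) i ∈ stdSimplex ℝ (Fin 2)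
  init_mem : ∀ i, x 0 i ∈ stdSimplex ℝ (Fin 2)
  init_pos : ∀ i s, 0 < x 0 i s
  step_fst : ∀ t : ℤ, 0 ≤ t → x (t + 1) 0 =
    mwStep (x t 0) (fun s =>
      2 * η * (payoff t).mulVec (x t 1) s - η * (payoff (t - 1)).mulVec (x (t - 1) 1) s)
  step_snd : ∀ t : ℤ, 0 ≤ t → x (t + 1) 1 =
    mwStep (x t 1) (fun s =>
      -(2 * η * (payoff t).transpose.mulVec (x t 0) s)
        + η * (payoff (t - 1)).transpose.mulVec (x (t - 1) 0) s)

/-- The unique equilibrium, common to both stage games: both players mix uniformly. -/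
def equilibrium : Fin 2 → Fin 2 → ℝ := fun _ _ => 1 / 2

/-- Kullback–Leibler divergence of two strategy profiles, summed over the two players. -/
def KL (p q : Fin 2 → Fin 2 → ℝ) : ℝ :=
  ∑ i, ∑ s, p i s * Real.log (p i s / q i s)

/-- The iterate vector at time `n`: the probabilities of the first pure strategy of each player
at times `n - 1` and `n`. -/
def iterVec (x : ℤ → Fin 2 → Fin 2 → ℝ) (n : ℤ) : Fin 4 → ℝ :=
  ![x (n - 1) 0 0, x n 0 0, x (n - 1) 1 0, x n 1 0]

/-- Position in the iterate vector of the entry of player `i` at time `n - 1` (`r = 0`) or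
`n` (`r = 1`). -/
def coord (i r : Fin 2) : Fin 4 := ![![0, 1], ![2, 3]] i r

/-- The map that advances the iterate vector by one step, from an even time `t`:
`(x₁ᵗ, x₁ᵗ⁺¹, x₂ᵗ, x₂ᵗ⁺¹) ↦ (x₁ᵗ⁺¹, x₁ᵗ⁺², x₂ᵗ⁺¹, x₂ᵗ⁺²)`. -/
def G₁ (η : ℝ) (z : Fin 4 → ℝ) : Fin 4 → ℝ :=
  ![z 1,
    z 1 * Real.exp (3 * η - 2 * η * z 3 - η * z 2) /
      (z 1 * Real.exp (3 * η - 2 * η * z 3 - η * z 2)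
        + (1 - z 1) * Real.exp (2 * η * z 3 + η * z 2)),
    z 3,
    z 3 * Real.exp (-3 * η + 2 * η * z 1 + η * z 0) /
      (z 3 * Real.exp (-3 * η + 2 * η * z 1 + η * z 0)
        + (1 - z 3) * Real.exp (-2 * η * z 1 - η * z 0))]

/-- The same for odd `t`. -/
def G₂ (η : ℝ) (z : Fin 4 → ℝ) : Fin 4 → ℝ :=
  ![z 1,
    z 1 * Real.exp (-3 * η + 2 * η * z 3 + η * z 2) /
      (z 1 * Real.exp (-3 * η + 2 * η * z 3 + η * z 2)
        + (1 - z 1) * Real.exp (-2 * η * z 3 - η * z 2)),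
    z 3,
    z 3 * Real.exp (3 * η - 2 * η * z 1 - η * z 0) /
      (z 3 * Real.exp (3 * η - 2 * η * z 1 - η * z 0)
        + (1 - z 3) * Real.exp (2 * η * z 1 + η * z 0))]

/-- `a e^{-3η} / (a e^{-3η} + 1 - a)`. -/
def shift (η a : ℝ) : ℝ :=
  a * Real.exp (-3 * η) / (a * Real.exp (-3 * η) + (1 - a))

/-- The point with parameter `a` of the family of fixed points on the face where player `i` does
not use strategy `s`.  For `i = s = 0` it is `(0, 0, a, shift η a)`; the other three are the
images under the order-four symmetry `(z₁, z₂, z₃, z₄) ↦ (1 - z₃, 1 - z₄, z₁, z₂)`. -/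
def facePoint (η : ℝ) (i s : Fin 2) (a : ℝ) : Fin 4 → ℝ :=
  (![![![0, 0, a, shift η a], ![1, 1, 1 - a, 1 - shift η a]],
     ![![1 - a, 1 - shift η a, 0, 0], ![a, shift η a, 1, 1]]] :
    Fin 2 → Fin 2 → Fin 4 → ℝ) i s

/-- The Jacobian matrix of `f` at `z`. -/
def jacobian (f : (Fin 4 → ℝ) → (Fin 4 → ℝ)) (z : Fin 4 → ℝ) : Matrix (Fin 4) (Fin 4) ℝ :=
  LinearMap.toMatrix' (fderiv ℝ f z : (Fin 4 → ℝ) →ₗ[ℝ] (Fin 4 → ℝ))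

/-- The fourth eigenvalue of the Jacobian at the fixed point with parameter `a`. -/
def fourthEigenvalue (η a : ℝ) : ℝ :=
  Real.exp (-(2 * η * a * (1 - a) * (Real.exp (3 * η) - 1) / (a + (1 - a) * Real.exp (3 * η))))

end PeriodicOMWU

end

/-! In log-odds the dynamics is additive: each step multiplies the odds of a player by the
exponential of an affine function of the opponent's entries (`tilt`, `G₁_eq`, `G₂_eq`). An
order-four symmetry commutes with both maps (`G₁_toFace`, `G₂_toFace`) and permutes the four faces,
so it is enough to study the face where the first two entries vanish. On that face the opponent's
log-odds move by `3 * η` and back, which gives the fixed points.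

Near the face, let `q` be the opponent's entry at an even time, `q'` its value one step later and
`q⁻` its value one step earlier. The `3 * η` terms cancel over two steps, and the first player's
log-odds change by `2 * η * (q + q⁻ - 2 * q')`. Because `q'` is about `tilt q (3 * η)` and `q⁻`
exceeds that by at most a small multiple of `q * (1 - q)`, this drift is negative and at least
comparable in size to `q * (1 - q)` (`drift_le`). The opponent's log-odds change only by an amount
proportional to the bound `θ` on the first player's odds. Both facts are combined in
`exists_nearFace_twoStep`.

If the opponent starts in the interior, `θ` decays geometrically, so the opponent's total
displacement in log-odds stays bounded, which in turn keeps the decay going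
(`exists_tendsto_of_interior`). Without that assumption there is a dichotomy on the sum of `q * (1 -
q)` (`exists_tendsto_boundary`). If the sum diverges, `θ` is driven to zero. If it converges, the
opponent's entries form a Cauchy sequence whose limit `l` satisfies `l * (1 - l) = 0`. In every case
some probability tends to `0`, and the divergence from equilibrium blows up (`IsOMWU.tendsto_KL`).

The spectrum is computed on one face, where the Jacobian is triangular after reordering the
coordinates, and is carried to the others by conjugation with the symmetry
(`charpoly_jacobian_of_conj`). -/

noncomputable section

namespace PeriodicOMWU

/-! ### Calculus of odds: translations of the log-odds. -/

/-- The probability obtained from `p` by multiplying its odds by `exp d`. -/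
def tilt (p d : ℝ) : ℝ := p * Real.exp d / (p * Real.exp d + (1 - p))

theorem tilt_den_pos {p : ℝ} (hp : p ∈ Set.Icc (0 : ℝ) 1) (d : ℝ) :
    0 < p * Real.exp d + (1 - p) := by
  have := Real.exp_pos d
  rcases hp.1.eq_or_lt with h | h
  · simp [← h]
  · have := hp.2
    have := mul_pos h (Real.exp_pos d)
    linarith

theorem tilt_exp_exp (p A B : ℝ) :
    p * Real.exp A / (p * Real.exp A + (1 - p) * Real.exp B) = tilt p (A - B) := by
  have hA : Real.exp A = Real.exp (A - B) * Real.exp B := by rw [← Real.exp_add]; ring_nf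
  rw [tilt, hA, ← mul_assoc, ← add_mul, mul_div_mul_right _ _ (Real.exp_pos B).ne']

@[simp] theorem tilt_zero_left (d : ℝ) : tilt 0 d = 0 := by simp [tilt]

@[simp] theorem tilt_zero_right (p : ℝ) : tilt p 0 = p := by simp [tilt]

theorem one_sub_tilt {p d : ℝ} (h : p * Real.exp d + (1 - p) ≠ 0) :
    1 - tilt p d = (1 - p) / (p * Real.exp d + (1 - p)) := by
  rw [tilt]; field_simp; ring

/-- Exchanging the two strategies negates the log-odds. The hypothesis is only a nonzero
denominator, not `p ∈ [0, 1]`, because the Jacobian argument needs the symmetry on a full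
neighborhood of a boundary point of the cube. -/
theorem tilt_one_sub {p d : ℝ} (h : p * Real.exp d + (1 - p) ≠ 0) :
    tilt (1 - p) (-d) = 1 - tilt p d := by
  rw [one_sub_tilt h, tilt, ← mul_div_mul_right _ _ (Real.exp_pos d).ne']
  have : Real.exp (-d) * Real.exp d = 1 := by rw [← Real.exp_add]; simp
  congr 1
  · rw [mul_assoc, this, mul_one]
  · rw [add_mul, mul_assoc, this]; ring

theorem tilt_mem {p : ℝ} (hp : p ∈ Set.Icc (0 : ℝ) 1) (d : ℝ) : tilt p d ∈ Set.Icc (0 : ℝ) 1 := by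
  have h := tilt_den_pos hp d
  constructor
  · exact div_nonneg (mul_nonneg hp.1 (Real.exp_pos d).le) h.le
  · rw [tilt, div_le_one h]; linarith [hp.2]

theorem tilt_mem_Ioo {p : ℝ} (hp : p ∈ Set.Ioo (0 : ℝ) 1) (d : ℝ) :
    tilt p d ∈ Set.Ioo (0 : ℝ) 1 := by
  have h := tilt_den_pos (Set.Ioo_subset_Icc_self hp) d
  constructor
  · exact div_pos (mul_pos hp.1 (Real.exp_pos d)) h
  · rw [tilt, div_lt_one h]; linarith [hp.2]

/-- The odds are multiplied by `exp d`. -/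
theorem tilt_odds {p : ℝ} (hp : p ∈ Set.Icc (0 : ℝ) 1) (d : ℝ) :
    tilt p d * (1 - p) = p * Real.exp d * (1 - tilt p d) := by
  have h := tilt_den_pos hp d
  rw [one_sub_tilt h.ne', tilt]; field_simp

/-- Tilts act by addition on log-odds. This is what makes the `3 * η` terms of consecutive steps
cancel. -/
theorem tilt_tilt {p : ℝ} (hp : p ∈ Set.Icc (0 : ℝ) 1) (d e : ℝ) :
    tilt (tilt p d) e = tilt p (d + e) := by
  have h := tilt_den_pos hp d
  rw [tilt, one_sub_tilt h.ne', tilt, tilt, Real.exp_add]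
  rw [div_mul_eq_mul_div, ← add_div, div_div_div_cancel_right₀ h.ne', mul_assoc]

theorem tilt_sub_self {p : ℝ} (hp : p ∈ Set.Icc (0 : ℝ) 1) (s : ℝ) :
    tilt p s - p = p * (1 - p) * ((Real.exp s - 1) / (p * Real.exp s + (1 - p))) := by
  have h := tilt_den_pos hp s
  rw [tilt]; field_simp; ring

theorem tilt_mono {p : ℝ} (hp : p ∈ Set.Icc (0 : ℝ) 1) {s t : ℝ} (hst : s ≤ t) :
    tilt p s ≤ tilt p t := by
  have h := tilt_den_pos hp s
  have h' := tilt_den_pos hp t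
  rw [tilt, tilt, div_le_div_iff₀ h h']
  have h1 := Real.exp_le_exp.2 hst
  have h2 : 0 ≤ p * (1 - p) := mul_nonneg hp.1 (by linarith [hp.2])
  nlinarith [mul_le_mul_of_nonneg_left h1 h2]

theorem tilt_den_le {p : ℝ} (hp : p ∈ Set.Icc (0 : ℝ) 1) (s : ℝ) :
    p * Real.exp s + (1 - p) ≤ Real.exp |s| := by
  have h1 : Real.exp s ≤ Real.exp |s| := Real.exp_le_exp.2 (le_abs_self s)
  have h2 : 1 ≤ Real.exp |s| := Real.one_le_exp (abs_nonneg s)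
  nlinarith [hp.1, hp.2]

/-- The factor `p * (1 - p)` is essential: displacements of the opponent have to be measured on the
same scale as the drift they compete with, uniformly up to the boundary. -/
theorem abs_tilt_sub_self_le {p : ℝ} (hp : p ∈ Set.Icc (0 : ℝ) 1) (s : ℝ) :
    |tilt p s - p| ≤ p * (1 - p) * (Real.exp |s| - 1) := by
  have h := tilt_den_pos hp s
  have h2 : 0 ≤ p * (1 - p) := mul_nonneg hp.1 (by linarith [hp.2])
  rw [tilt_sub_self hp, abs_mul, abs_of_nonneg h2]
  refine mul_le_mul_of_nonneg_left ?_ h2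
  rw [abs_div, abs_of_pos h, div_le_iff₀ h]
  rcases le_total 0 s with hs | hs
  · have h3 : 1 ≤ Real.exp s := Real.one_le_exp hs
    rw [abs_of_nonneg hs, abs_of_nonneg (by linarith)]
    have : 1 ≤ p * Real.exp s + (1 - p) := by nlinarith [hp.1]
    nlinarith
  · have h3 : Real.exp s ≤ 1 := Real.exp_le_one_iff.2 hs
    rw [abs_of_nonpos hs, abs_of_nonpos (by linarith)]
    have h5 : 1 ≤ Real.exp (-s) := Real.one_le_exp (by linarith)
    have h4 : Real.exp s ≤ p * Real.exp s + (1 - p) := by nlinarith [hp.2]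
    have h6 : Real.exp (-s) * Real.exp s = 1 := by rw [← Real.exp_add]; simp
    nlinarith [mul_le_mul_of_nonneg_left h4 (sub_nonneg.2 h5)]

theorem tilt_mul_one_sub {p : ℝ} (hp : p ∈ Set.Icc (0 : ℝ) 1) (s : ℝ) :
    tilt p s * (1 - tilt p s) = p * (1 - p) * Real.exp s / (p * Real.exp s + (1 - p)) ^ 2 := by
  have h := tilt_den_pos hp s
  rw [one_sub_tilt h.ne', tilt, div_mul_div_comm]; ring

/-- A bounded displacement in log-odds costs `p * (1 - p)` at most a constant factor, so the drift
rate survives as long as the opponent's total displacement is bounded. -/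
theorem mul_exp_neg_abs_le_tilt {p : ℝ} (hp : p ∈ Set.Icc (0 : ℝ) 1) (s : ℝ) :
    p * (1 - p) * Real.exp (-|s|) ≤ tilt p s * (1 - tilt p s) := by
  have h := tilt_den_pos hp s
  have h2 : 0 ≤ p * (1 - p) := mul_nonneg hp.1 (by linarith [hp.2])
  rw [tilt_mul_one_sub hp, mul_div_assoc]
  refine mul_le_mul_of_nonneg_left ?_ h2
  rw [le_div_iff₀ (by positivity)]
  rcases le_total 0 s with hs | hs
  · have h3 := tilt_den_le hp s
    rw [abs_of_nonneg hs] at h3 ⊢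
    calc Real.exp (-s) * (p * Real.exp s + (1 - p)) ^ 2 ≤ Real.exp (-s) * Real.exp s ^ 2 := by
          gcongr
      _ = Real.exp s := by rw [sq, ← mul_assoc, ← Real.exp_add]; simp
  · have h3 : Real.exp s ≤ 1 := Real.exp_le_one_iff.2 hs
    rw [abs_of_nonpos hs, neg_neg]
    have h4 : p * Real.exp s + (1 - p) ≤ 1 := by nlinarith [hp.1]
    calc Real.exp s * (p * Real.exp s + (1 - p)) ^ 2 ≤ Real.exp s * 1 ^ 2 := by gcongr
      _ = Real.exp s := by ring

theorem tilt_mul_one_sub_le {p : ℝ} (hp : p ∈ Set.Icc (0 : ℝ) 1) {s : ℝ} (hs : 0 ≤ s) :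
    tilt p s * (1 - tilt p s) ≤ p * (1 - p) * Real.exp s := by
  have h2 : 0 ≤ p * (1 - p) := mul_nonneg hp.1 (by linarith [hp.2])
  rw [tilt_mul_one_sub hp]
  have h3 : 1 ≤ Real.exp s := Real.one_le_exp hs
  have h4 : 1 ≤ p * Real.exp s + (1 - p) := by nlinarith [hp.1]
  exact div_le_self (by positivity) (one_le_pow₀ h4)

/-- An increase of the log-odds by at most `L` multiplies the odds by at most `exp L`. -/
theorem tilt_le_of_odds_le {p d L θ : ℝ} (hp : p ∈ Set.Icc (0 : ℝ) 1) (hd : d ≤ L)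
    (h : p ≤ θ * (1 - p)) :
    tilt p d ≤ θ * Real.exp L * (1 - tilt p d) := by
  have hp1 : 0 < 1 - p := by
    rcases hp.2.eq_or_lt with h1 | h1
    · rw [h1] at h; norm_num at h
    · linarith
  have h0 := tilt_odds hp d
  have hm := tilt_mem hp d
  have he : Real.exp d ≤ Real.exp L := Real.exp_le_exp.2 hd
  refine le_of_mul_le_mul_right ?_ hp1
  rw [h0]
  have h1m : 0 ≤ 1 - tilt p d := by linarith [hm.2]
  calc p * Real.exp d * (1 - tilt p d) ≤ (θ * (1 - p)) * Real.exp L * (1 - tilt p d) := by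
        gcongr
        exact hp.1.trans h
    _ = _ := by ring

/-! ### The two maps in log-odds form and their order-four symmetry. -/

theorem G₁_eq (η : ℝ) (z : Fin 4 → ℝ) :
    G₁ η z = ![z 1, tilt (z 1) (3 * η - 4 * η * z 3 - 2 * η * z 2), z 3,
      tilt (z 3) (-(3 * η) + 4 * η * z 1 + 2 * η * z 0)] := by
  rw [G₁, tilt_exp_exp, tilt_exp_exp]
  ring_nf

theorem G₂_eq (η : ℝ) (z : Fin 4 → ℝ) :
    G₂ η z = ![z 1, tilt (z 1) (-(3 * η) + 4 * η * z 3 + 2 * η * z 2), z 3,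
      tilt (z 3) (3 * η - 4 * η * z 1 - 2 * η * z 0)] := by
  rw [G₂, tilt_exp_exp, tilt_exp_exp]
  ring_nf

theorem shift_eq (η a : ℝ) : shift η a = tilt a (-(3 * η)) := by
  rw [shift, tilt, neg_mul]

/-- The unit cube of iterate vectors. -/
def cube : Set (Fin 4 → ℝ) := {z | ∀ k, z k ∈ Set.Icc (0 : ℝ) 1}

theorem vec_mem_cube {a b c d : ℝ} (ha : a ∈ Set.Icc (0 : ℝ) 1) (hb : b ∈ Set.Icc (0 : ℝ) 1)
    (hc : c ∈ Set.Icc (0 : ℝ) 1) (hd : d ∈ Set.Icc (0 : ℝ) 1) : ![a, b, c, d] ∈ cube := by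
  intro k
  fin_cases k
  exacts [ha, hb, hc, hd]

theorem G₁_mem_cube (η : ℝ) {z : Fin 4 → ℝ} (hz : z ∈ cube) : G₁ η z ∈ cube := by
  rw [G₁_eq]
  exact vec_mem_cube (hz 1) (tilt_mem (hz 1) _) (hz 3) (tilt_mem (hz 3) _)

theorem G₂_mem_cube (η : ℝ) {z : Fin 4 → ℝ} (hz : z ∈ cube) : G₂ η z ∈ cube := by
  rw [G₂_eq]
  exact vec_mem_cube (hz 1) (tilt_mem (hz 1) _) (hz 3) (tilt_mem (hz 3) _)

/-- Two steps of the dynamics. -/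
abbrev twoStep (η : ℝ) : (Fin 4 → ℝ) → (Fin 4 → ℝ) := G₁ η ∘ G₂ η

/-- The power of the order-four symmetry of the dynamics that takes the face on which player `i`
does not use strategy `s` to the face on which player `0` does not use strategy `0`. -/
def toFace (i s : Fin 2) (z : Fin 4 → ℝ) : Fin 4 → ℝ :=
  (![![![z 0, z 1, z 2, z 3], ![1 - z 0, 1 - z 1, 1 - z 2, 1 - z 3]],
     ![![z 2, z 3, 1 - z 0, 1 - z 1], ![1 - z 2, 1 - z 3, z 0, z 1]]] :
    Fin 2 → Fin 2 → Fin 4 → ℝ) i s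

/-- The inverse of `toFace`. -/
def ofFace (i s : Fin 2) (z : Fin 4 → ℝ) : Fin 4 → ℝ :=
  (![![![z 0, z 1, z 2, z 3], ![1 - z 0, 1 - z 1, 1 - z 2, 1 - z 3]],
     ![![1 - z 2, 1 - z 3, z 0, z 1], ![z 2, z 3, 1 - z 0, 1 - z 1]]] :
    Fin 2 → Fin 2 → Fin 4 → ℝ) i s

theorem ofFace_toFace (i s : Fin 2) (z : Fin 4 → ℝ) : ofFace i s (toFace i s z) = z := by
  ext k
  fin_cases i <;> fin_cases s <;> fin_cases k <;> simp [toFace, ofFace]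

theorem toFace_ofFace (i s : Fin 2) (z : Fin 4 → ℝ) : toFace i s (ofFace i s z) = z := by
  ext k
  fin_cases i <;> fin_cases s <;> fin_cases k <;> simp [toFace, ofFace]

theorem toFace_facePoint (η : ℝ) (i s : Fin 2) (a : ℝ) :
    toFace i s (facePoint η i s a) = ![0, 0, a, shift η a] := by
  fin_cases i <;> fin_cases s <;> simp [toFace, facePoint]

theorem toFace_mem_cube (i s : Fin 2) {z : Fin 4 → ℝ} (hz : z ∈ cube) : toFace i s z ∈ cube := by
  have h : ∀ k, 1 - z k ∈ Set.Icc (0 : ℝ) 1 := fun k =>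
    ⟨by linarith [(hz k).2], by linarith [(hz k).1]⟩
  fin_cases i <;> fin_cases s <;> simp only [toFace] <;> apply vec_mem_cube
  all_goals first | exact hz _ | exact h _

/-- Each coordinate is permuted and possibly reflected by `u ↦ 1 - u`, which preserves the sup
distance. The inverse has the same form, hence both inequalities. -/
theorem dist_toFace (i s : Fin 2) (z w : Fin 4 → ℝ) :
    dist (toFace i s z) (toFace i s w) = dist z w := by
  have h : ∀ (z w : Fin 4 → ℝ) (k : Fin 4), dist (1 - z k) (1 - w k) ≤ dist z w := fun z w k => by
    rw [dist_sub_left]; exact dist_le_pi_dist z w k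
  refine le_antisymm ?_ ?_
  · refine (dist_pi_le_iff dist_nonneg).2 fun k => ?_
    fin_cases i <;> fin_cases s <;> fin_cases k <;>
      first | exact dist_le_pi_dist z w _ | exact h z w _
  · conv_lhs => rw [← ofFace_toFace i s z, ← ofFace_toFace i s w]
    generalize toFace i s z = z, toFace i s w = w
    refine (dist_pi_le_iff dist_nonneg).2 fun k => ?_
    fin_cases i <;> fin_cases s <;> fin_cases k <;>
      first | exact dist_le_pi_dist z w _ | exact h z w _

/-- The denominators in `G₁ η z` do not vanish. -/
def Regular₁ (η : ℝ) (z : Fin 4 → ℝ) : Prop :=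
  z 1 * Real.exp (3 * η - 4 * η * z 3 - 2 * η * z 2) + (1 - z 1) ≠ 0 ∧
    z 3 * Real.exp (-(3 * η) + 4 * η * z 1 + 2 * η * z 0) + (1 - z 3) ≠ 0

/-- The denominators in `G₂ η z` do not vanish. -/
def Regular₂ (η : ℝ) (z : Fin 4 → ℝ) : Prop :=
  z 1 * Real.exp (-(3 * η) + 4 * η * z 3 + 2 * η * z 2) + (1 - z 1) ≠ 0 ∧
    z 3 * Real.exp (3 * η - 4 * η * z 1 - 2 * η * z 0) + (1 - z 3) ≠ 0

theorem regular₁_of_mem_cube (η : ℝ) {z : Fin 4 → ℝ} (hz : z ∈ cube) : Regular₁ η z :=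
  ⟨(tilt_den_pos (hz 1) _).ne', (tilt_den_pos (hz 3) _).ne'⟩

theorem regular₂_of_mem_cube (η : ℝ) {z : Fin 4 → ℝ} (hz : z ∈ cube) : Regular₂ η z :=
  ⟨(tilt_den_pos (hz 1) _).ne', (tilt_den_pos (hz 3) _).ne'⟩

theorem G₁_toFace (η : ℝ) (i s : Fin 2) {z : Fin 4 → ℝ} (hz : Regular₁ η z) :
    G₁ η (toFace i s z) = toFace i s (G₁ η z) := by
  have h1 := tilt_one_sub hz.1
  have h2 := tilt_one_sub hz.2
  rw [G₁_eq, G₁_eq]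
  fin_cases i <;> fin_cases s <;> simp [toFace, ← h1, ← h2] <;> constructor <;> ring_nf

theorem G₂_toFace (η : ℝ) (i s : Fin 2) {z : Fin 4 → ℝ} (hz : Regular₂ η z) :
    G₂ η (toFace i s z) = toFace i s (G₂ η z) := by
  have h1 := tilt_one_sub hz.1
  have h2 := tilt_one_sub hz.2
  rw [G₂_eq, G₂_eq]
  fin_cases i <;> fin_cases s <;> simp [toFace, ← h1, ← h2] <;> constructor <;> ring_nf

theorem twoStep_toFace (η : ℝ) (i s : Fin 2) {z : Fin 4 → ℝ} (hz : z ∈ cube) :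
    twoStep η (toFace i s z) = toFace i s (twoStep η z) := by
  simp only [twoStep, Function.comp_apply]
  rw [G₂_toFace η i s (regular₂_of_mem_cube η hz),
    G₁_toFace η i s (regular₁_of_mem_cube η (G₂_mem_cube η hz))]

theorem twoStep_mem_cube (η : ℝ) {z : Fin 4 → ℝ} (hz : z ∈ cube) : twoStep η z ∈ cube :=
  G₁_mem_cube η (G₂_mem_cube η hz)

theorem iterate_twoStep_mem_cube (η : ℝ) {z : Fin 4 → ℝ} (hz : z ∈ cube) (m : ℕ) :
    (twoStep η)^[m] z ∈ cube := by
  induction m with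
  | zero => exact hz
  | succ m ih => rw [Function.iterate_succ_apply']; exact twoStep_mem_cube η ih

theorem iterate_twoStep_toFace (η : ℝ) (i s : Fin 2) {z : Fin 4 → ℝ} (hz : z ∈ cube) (m : ℕ) :
    (twoStep η)^[m] (toFace i s z) = toFace i s ((twoStep η)^[m] z) := by
  induction m with
  | zero => rfl
  | succ m ih =>
    rw [Function.iterate_succ_apply', ih, twoStep_toFace η i s (iterate_twoStep_mem_cube η hz m),
      Function.iterate_succ_apply']

theorem basePoint_mem_cube (η : ℝ) {a : ℝ} (ha : a ∈ Set.Icc (0 : ℝ) 1) :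
    ![0, 0, a, shift η a] ∈ cube := by
  rw [shift_eq]
  exact vec_mem_cube (by simp) (by simp) ha (tilt_mem ha _)

theorem facePoint_mem_cube (η : ℝ) (i s : Fin 2) {a : ℝ} (ha : a ∈ Set.Icc (0 : ℝ) 1) :
    facePoint η i s a ∈ cube := by
  have hs : shift η a ∈ Set.Icc (0 : ℝ) 1 := by rw [shift_eq]; exact tilt_mem ha _
  have h : ∀ {b : ℝ}, b ∈ Set.Icc (0 : ℝ) 1 → 1 - b ∈ Set.Icc (0 : ℝ) 1 := fun hb =>
    ⟨by linarith [hb.2], by linarith [hb.1]⟩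
  fin_cases i <;> fin_cases s <;> simp only [facePoint] <;> apply vec_mem_cube
  all_goals first | exact ha | exact hs | exact h ha | exact h hs | simp

/-! ### Fixed points on the faces. -/

/-- On the face, two steps restore the mixed strategy of the opponent. -/
theorem twoStep_of_face (η q : ℝ) {b : ℝ} (hb : b ∈ Set.Icc (0 : ℝ) 1) :
    twoStep η ![0, 0, q, b] = ![0, 0, tilt b (3 * η), b] := by
  simp only [twoStep, Function.comp_apply, G₁_eq, G₂_eq]
  simp [tilt_tilt hb]

theorem isFixedPt_facePoint (η : ℝ) (i s : Fin 2) {a : ℝ} (ha : a ∈ Set.Icc (0 : ℝ) 1) :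
    Function.IsFixedPt (twoStep η) (facePoint η i s a) := by
  have h := twoStep_toFace η i s (facePoint_mem_cube η i s ha)
  rw [toFace_facePoint, shift_eq, twoStep_of_face η a (tilt_mem ha _), tilt_tilt ha,
    neg_add_cancel, tilt_zero_right, ← shift_eq] at h
  have h' := congrArg (ofFace i s) h
  rw [ofFace_toFace, ← toFace_facePoint η i s a, ofFace_toFace] at h'
  exact h'.symm

theorem twoStep_eq (η : ℝ) (z : Fin 4 → ℝ) {p q : ℝ}
    (hp : p = tilt (z 1) (-(3 * η) + 4 * η * z 3 + 2 * η * z 2))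
    (hq : q = tilt (z 3) (3 * η - 4 * η * z 1 - 2 * η * z 0)) :
    twoStep η z = ![p, tilt p (3 * η - 4 * η * q - 2 * η * z 3), q,
      tilt q (-(3 * η) + 4 * η * p + 2 * η * z 1)] := by
  rw [hp, hq]
  simp only [twoStep, Function.comp_apply, G₁_eq, G₂_eq]
  simp

/-! ### Contraction towards the face. -/

/-- The iterate vector `z`, at an even time, has its first two entries near `0`, with odds
bounded by `θ`, and its last two entries are related as in the dynamics. -/
structure NearFace (η θ : ℝ) (z : Fin 4 → ℝ) : Prop where
  mem_cube : z ∈ cube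
  odds_le : z 1 ≤ θ * (1 - z 1)
  prev_le : z 0 ≤ 2 * Real.exp (3 * η) * θ
  linked : ∃ e ∈ Set.Icc 0 (6 * η), z 3 = tilt (z 2) (-(3 * η) + e)

theorem NearFace.mono {η θ θ' : ℝ} {z : Fin 4 → ℝ} (h : NearFace η θ z) (hθ : θ ≤ θ') :
    NearFace η θ' z where
  mem_cube := h.mem_cube
  odds_le := h.odds_le.trans
    (mul_le_mul_of_nonneg_right hθ (by linarith [(h.mem_cube 1).2]))
  prev_le := h.prev_le.trans (mul_le_mul_of_nonneg_left hθ (by positivity))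
  linked := h.linked

theorem NearFace.nonneg {η θ : ℝ} {z : Fin 4 → ℝ} (h : NearFace η θ z) : 0 ≤ θ := by
  have h1 := (h.mem_cube 0).1.trans h.prev_le
  exact nonneg_of_mul_nonneg_right h1 (by positivity)

theorem NearFace.le {η θ : ℝ} {z : Fin 4 → ℝ} (h : NearFace η θ z) : z 1 ≤ θ := by
  have h1 := h.odds_le
  nlinarith [(h.mem_cube 1).1, h.nonneg]

/-- Inverts the link: the opponent's previous entry becomes a tilt of the current one, so that all
quantities in the drift are tilts of `z 3`. -/
theorem NearFace.exists_prev {η θ : ℝ} {z : Fin 4 → ℝ} (h : NearFace η θ z) :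
    ∃ e ∈ Set.Icc 0 (6 * η), z 2 = tilt (z 3) (3 * η - e) := by
  obtain ⟨e, he, h1⟩ := h.linked
  refine ⟨e, he, ?_⟩
  rw [h1, tilt_tilt (h.mem_cube 2)]
  ring_nf
  simp

/-- The two-step drift of the log-odds is negative and comparable to `q (1 - q)`. -/
theorem drift_le {η f₀ q e f : ℝ} (hη : 0 < η) (hf₀ : f₀ ≤ η)
    (hf₀' : Real.exp (3 * η) * (Real.exp f₀ - 1) ≤ (1 - Real.exp (-(2 * η))) / 2)
    (hq : q ∈ Set.Icc (0 : ℝ) 1) (he : 0 ≤ e) (hf : 0 ≤ f) (hff : f ≤ f₀) :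
    q + tilt q (3 * η - e) - 2 * tilt q (3 * η - f) ≤
      -((1 - Real.exp (-(2 * η))) / 2 * (q * (1 - q))) := by
  have hq0 : 0 ≤ q * (1 - q) := mul_nonneg hq.1 (by linarith [hq.2])
  set q' := tilt q (3 * η - f) with hq'
  have hm : q' ∈ Set.Icc (0 : ℝ) 1 := tilt_mem hq _
  -- The opponent's previous entry can exceed `q'` only through the perturbation `f`; this excess is
  -- at most half of the gain `q' - q` estimated in `h5`.
  have h1 : tilt q (3 * η - e) ≤ tilt q' f := by
    rw [hq', tilt_tilt hq]
    exact tilt_mono hq (by linarith)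
  have h2 : tilt q' f - q' ≤ q' * (1 - q') * (Real.exp f - 1) := by
    have := (le_abs_self _).trans (abs_tilt_sub_self_le hm f)
    rwa [abs_of_nonneg hf] at this
  have h3 : q' * (1 - q') ≤ q * (1 - q) * Real.exp (3 * η) :=
    (tilt_mul_one_sub_le hq (by linarith)).trans
      (mul_le_mul_of_nonneg_left (Real.exp_le_exp.2 (by linarith)) hq0)
  have h4 : q' * (1 - q') * (Real.exp f - 1) ≤
      q * (1 - q) * ((1 - Real.exp (-(2 * η))) / 2) := by
    have hef : Real.exp f ≤ Real.exp f₀ := Real.exp_le_exp.2 hff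
    have hef' : 1 ≤ Real.exp f := Real.one_le_exp hf
    calc q' * (1 - q') * (Real.exp f - 1)
        ≤ q * (1 - q) * Real.exp (3 * η) * (Real.exp f₀ - 1) := by
          apply mul_le_mul h3 (by linarith) (by linarith) (by positivity)
      _ = q * (1 - q) * (Real.exp (3 * η) * (Real.exp f₀ - 1)) := by ring
      _ ≤ _ := mul_le_mul_of_nonneg_left hf₀' hq0
  -- As `f ≤ η`, the tilt leading to `q'` is at least `2 * η`.
  have h5 : q * (1 - q) * (1 - Real.exp (-(2 * η))) ≤ q' - q := by
    have hmono : tilt q (2 * η) ≤ q' := tilt_mono hq (by linarith)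
    refine le_trans ?_ (sub_le_sub_right hmono q)
    rw [tilt_sub_self hq]
    refine mul_le_mul_of_nonneg_left ?_ hq0
    rw [le_div_iff₀ (tilt_den_pos hq _)]
    have h6 := tilt_den_le hq (2 * η)
    rw [abs_of_pos (by linarith)] at h6
    have h7 : Real.exp (-(2 * η)) * Real.exp (2 * η) = 1 := by rw [← Real.exp_add]; simp
    have h8 : Real.exp (-(2 * η)) ≤ 1 := Real.exp_le_one_iff.2 (by linarith)
    nlinarith [mul_le_mul_of_nonneg_left h6 (sub_nonneg.2 h8)]
  linarith

theorem exists_drift_bound {η : ℝ} (hη : 0 < η) : ∃ f₀ > 0, f₀ ≤ η ∧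
    Real.exp (3 * η) * (Real.exp f₀ - 1) ≤ (1 - Real.exp (-(2 * η))) / 2 := by
  have hc : 0 < (1 - Real.exp (-(2 * η))) / 2 := by
    have : Real.exp (-(2 * η)) < 1 := Real.exp_lt_one_iff.2 (by linarith)
    linarith
  have h : ContinuousAt (fun f : ℝ => Real.exp (3 * η) * (Real.exp f - 1)) 0 := by fun_prop
  have h1 : ∀ᶠ f in 𝓝 (0 : ℝ), Real.exp (3 * η) * (Real.exp f - 1) <
      (1 - Real.exp (-(2 * η))) / 2 := h.eventually_lt_const (by simpa using hc)
  obtain ⟨f, hf, hf0⟩ := (((h1.and (eventually_lt_nhds hη)).filter_mono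
    (nhdsWithin_le_nhds (s := Set.Ioi 0))).and self_mem_nhdsWithin).exists
  exact ⟨f, hf0, hf.2.le, hf.1.le⟩

theorem mul_one_sub_le_quarter (q : ℝ) : q * (1 - q) ≤ 1 / 4 := by
  nlinarith [sq_nonneg (q - 1 / 2)]

/-- Two steps near the face: the bound on the odds of the first player contracts, and the
log-odds of the opponent change by little. -/
theorem exists_nearFace_twoStep {η : ℝ} (hη : 0 < η) : ∃ θ₀ > 0, ∃ c > 0, ∀ θ ≤ θ₀, ∀ z,
    NearFace η θ z →
      NearFace η (θ * Real.exp (-(c * (z 3 * (1 - z 3))))) (twoStep η z) ∧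
      ∃ s, |s| ≤ 10 * η * Real.exp (3 * η) * θ ∧ twoStep η z 3 = tilt (z 3) s := by
  obtain ⟨f₀, hf₀, hf₁, hf₂⟩ := exists_drift_bound hη
  have hc₀ : 0 < (1 - Real.exp (-(2 * η))) / 2 := by
    have : Real.exp (-(2 * η)) < 1 := Real.exp_lt_one_iff.2 (by linarith)
    linarith
  set c₀ := (1 - Real.exp (-(2 * η))) / 2 with hc₀'
  have hE : 1 ≤ Real.exp (3 * η) := Real.one_le_exp (by linarith)
  set E := Real.exp (3 * η) with hEdef
  -- The perturbation `4 * η * z 1 + 2 * η * z 0` is at most `8 * η * E * θ`, so this threshold puts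
  -- it below `f₀`. The minimum with `1` keeps a single contraction factor above `1 / 2`.
  refine ⟨f₀ / (8 * η * E), by positivity, min 1 (2 * η * c₀), by positivity, ?_⟩
  intro θ hθ z hz
  rw [le_div_iff₀ (by positivity)] at hθ
  have hθ0 := hz.nonneg
  have hz0 := hz.mem_cube 0
  have hz1 := hz.mem_cube 1
  have hz2 := hz.mem_cube 2
  have hz3 := hz.mem_cube 3
  have hle := hz.le
  have hprev := hz.prev_le
  have hqq : 0 ≤ z 3 * (1 - z 3) := mul_nonneg hz3.1 (by linarith [hz3.2])
  obtain ⟨p, hp⟩ : ∃ p, p = tilt (z 1) (-(3 * η) + 4 * η * z 3 + 2 * η * z 2) := ⟨_, rfl⟩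
  obtain ⟨q, hq⟩ : ∃ q, q = tilt (z 3) (3 * η - 4 * η * z 1 - 2 * η * z 0) := ⟨_, rfl⟩
  have hpm : p ∈ Set.Icc (0 : ℝ) 1 := hp ▸ tilt_mem hz1 _
  have hqm : q ∈ Set.Icc (0 : ℝ) 1 := hq ▸ tilt_mem hz3 _
  have hp' : p ≤ E * θ := by
    have := tilt_le_of_odds_le (d := -(3 * η) + 4 * η * z 3 + 2 * η * z 2) (L := 3 * η) hz1
      (by nlinarith [hz3.2, hz2.2]) hz.odds_le
    rw [← hp] at this
    nlinarith [mul_nonneg hθ0 (zero_le_one.trans hE), hpm.1]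
  have hEθ : θ ≤ E * θ := le_mul_of_one_le_left hθ0 hE
  obtain ⟨e, he, hqe⟩ := hz.exists_prev
  have hdrift := drift_le hη hf₁ hf₂ hz3 he.1 (f := 4 * η * z 1 + 2 * η * z 0)
    (by have := hz1.1; have := hz0.1; positivity)
    (by nlinarith [mul_le_mul_of_nonneg_left hle hη.le, mul_le_mul_of_nonneg_left hprev hη.le,
          mul_le_mul_of_nonneg_left hEθ hη.le])
  rw [← hqe, ← sub_sub, ← hq, ← hc₀'] at hdrift
  -- The new previous entry `p` is bounded by `E` times the old `θ`. The factor `2` in `prev_le`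
  -- absorbs the passage to the contracted `θ`.
  have hexp : 1 / 2 ≤ Real.exp (-(min 1 (2 * η * c₀) * (z 3 * (1 - z 3)))) := by
    have h1 : min 1 (2 * η * c₀) * (z 3 * (1 - z 3)) ≤ 1 / 4 := by
      have := mul_le_mul (min_le_left 1 (2 * η * c₀)) (mul_one_sub_le_quarter (z 3)) hqq one_pos.le
      linarith
    linarith [Real.add_one_le_exp (-(min 1 (2 * η * c₀) * (z 3 * (1 - z 3))))]
  have heq := twoStep_eq η z hp hq
  have hmem := twoStep_mem_cube η hz.mem_cube
  -- The first witness is the perturbation in the second half-step and gives the new link. The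
  -- second is the opponent's net exponent over both half-steps, where `3 * η` and `-(3 * η)` have
  -- cancelled.
  refine ⟨⟨hmem, ?_, ?_, 4 * η * p + 2 * η * z 1, ⟨?_, ?_⟩, ?_⟩,
    4 * η * p - 2 * η * z 1 - 2 * η * z 0, ?_, ?_⟩
  · have h1 : twoStep η z 1 = tilt (z 1) (2 * η * (z 3 + z 2 - 2 * q)) := by
      rw [heq]
      change tilt p _ = _
      rw [hp, tilt_tilt hz1]
      ring_nf
    rw [h1]
    refine tilt_le_of_odds_le hz1 ?_ hz.odds_le
    have h2 := mul_le_mul_of_nonneg_left hdrift (by positivity : 0 ≤ 2 * η)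
    have h3 := mul_le_mul_of_nonneg_right (min_le_right 1 (2 * η * c₀)) hqq
    linarith
  · rw [heq]
    change p ≤ _
    nlinarith [mul_le_mul_of_nonneg_left hexp (mul_nonneg (zero_le_one.trans hE) hθ0)]
  · have := hpm.1; have := hz1.1; positivity
  · nlinarith [hpm.2, hz1.2]
  · rw [heq]
    change tilt q _ = tilt q _
    ring_nf
  · have h1 := mul_le_mul_of_nonneg_left hle hη.le
    have h2 := mul_le_mul_of_nonneg_left hprev hη.le
    have h3 := mul_le_mul_of_nonneg_left hEθ hη.le
    have h4 := mul_le_mul_of_nonneg_left hp' hη.le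
    have h5 := mul_nonneg hη.le hpm.1
    have h6 := mul_nonneg hη.le hz1.1
    have h7 := mul_nonneg hη.le hz0.1
    rw [abs_le]
    constructor <;> nlinarith
  · rw [heq]
    change tilt q _ = _
    rw [hq, tilt_tilt hz3]
    ring_nf

theorem tendsto_of_nearFace {η : ℝ} {z : ℕ → Fin 4 → ℝ} {θ : ℕ → ℝ}
    (h : ∀ m, NearFace η (θ m) (z m)) (hθ : Tendsto θ atTop (𝓝 0)) :
    Tendsto (fun m => z m 0) atTop (𝓝 0) ∧ Tendsto (fun m => z m 1) atTop (𝓝 0) := by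
  constructor
  · have h1 := hθ.const_mul (2 * Real.exp (3 * η))
    rw [mul_zero] at h1
    exact squeeze_zero (fun m => ((h m).mem_cube 0).1) (fun m => (h m).prev_le) h1
  · exact squeeze_zero (fun m => ((h m).mem_cube 1).1) (fun m => (h m).le) hθ

/-- If the opponent is away from the boundary, a point near the face is attracted to it. -/
theorem exists_tendsto_of_interior {η : ℝ} (hη : 0 < η) {κ : ℝ} (hκ : 0 < κ) :
    ∃ θ > 0, ∀ z, NearFace η θ z → κ ≤ z 3 * (1 - z 3) →
      Tendsto (fun m => (twoStep η)^[m] z 0) atTop (𝓝 0) ∧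
      Tendsto (fun m => (twoStep η)^[m] z 1) atTop (𝓝 0) := by
  obtain ⟨θ₀, hθ₀, c, hc, H⟩ := exists_nearFace_twoStep hη
  -- The opponent's log-odds will be kept within `1` of their start, so the drift weight stays at
  -- least `κ * exp (-1)` and `r` bounds every contraction factor.
  set r := Real.exp (-(c * (κ * Real.exp (-1)))) with hr
  have hr0 : 0 < r := Real.exp_pos _
  have hr1 : r < 1 := Real.exp_lt_one_iff.2 (by have := Real.exp_pos (-1); nlinarith [mul_pos hκ this])
  set K := 10 * η * Real.exp (3 * η) with hK
  have hK0 : 0 < K := by positivity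
  have h1r : 0 < 1 - r := by linarith
  refine ⟨min θ₀ ((1 - r) / K), by positivity, fun z hz hκz => ?_⟩
  set θ := min θ₀ ((1 - r) / K) with hθ
  have hθ0 := hz.nonneg
  have hKθ : K * θ ≤ 1 - r := by
    have := min_le_right θ₀ ((1 - r) / K)
    rwa [← hθ, le_div_iff₀' hK0] at this
  -- Joint induction: decay of the odds bounds the opponent's next displacement by `(1 - r) * r ^
  -- m`, and the telescoped bound `1 - r ^ m ≤ 1` on its total displacement sustains the decay.
  have key : ∀ m : ℕ, NearFace η (θ * r ^ m) ((twoStep η)^[m] z) ∧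
      ∃ s, |s| ≤ 1 - r ^ m ∧ (twoStep η)^[m] z 3 = tilt (z 3) s := by
    intro m
    induction m with
    | zero => exact ⟨by simpa using hz, 0, by simp, by simp⟩
    | succ m ih =>
      obtain ⟨hm, s, hs, hms⟩ := ih
      have hrm : 0 < r ^ m := pow_pos hr0 m
      have hrm1 : r ^ m ≤ 1 := pow_le_one₀ hr0.le hr1.le
      obtain ⟨h1, s', hs', h2⟩ := H (θ * r ^ m)
        ((mul_le_of_le_one_right hθ0 hrm1).trans (min_le_left _ _)) _ hm
      rw [Function.iterate_succ_apply']
      refine ⟨h1.mono ?_, s + s', ?_, ?_⟩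
      · rw [pow_succ, ← mul_assoc θ]
        refine mul_le_mul_of_nonneg_left (Real.exp_le_exp.2 ?_) (by positivity)
        refine neg_le_neg (mul_le_mul_of_nonneg_left ?_ hc.le)
        rw [hms]
        refine le_trans ?_ (mul_exp_neg_abs_le_tilt (hz.mem_cube 3) s)
        exact mul_le_mul hκz (Real.exp_le_exp.2 (by linarith)) (Real.exp_pos _).le
          (hκ.le.trans hκz)
      · refine (abs_add_le s s').trans ?_
        have : K * (θ * r ^ m) ≤ (1 - r) * r ^ m := by
          rw [← mul_assoc]; exact mul_le_mul_of_nonneg_right hKθ hrm.le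
        rw [pow_succ]
        linarith
      · rw [h2, hms, tilt_tilt (hz.mem_cube 3)]
  refine tendsto_of_nearFace (fun m => (key m).1) ?_
  simpa using (tendsto_pow_atTop_nhds_zero_of_lt_one hr0.le hr1).const_mul θ

/-- From a point near the face, at least one player is attracted to the boundary. -/
theorem exists_tendsto_boundary {η : ℝ} (hη : 0 < η) :
    ∃ θ > 0, ∀ z, NearFace η θ z →
      (Tendsto (fun m => (twoStep η)^[m] z 0) atTop (𝓝 0) ∧
        Tendsto (fun m => (twoStep η)^[m] z 1) atTop (𝓝 0)) ∨
      ∃ l : ℝ, (l = 0 ∨ l = 1) ∧ Tendsto (fun m => (twoStep η)^[m] z 2) atTop (𝓝 l) ∧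
        Tendsto (fun m => (twoStep η)^[m] z 3) atTop (𝓝 l) := by
  obtain ⟨θ, hθ, c, hc, H⟩ := exists_nearFace_twoStep hη
  refine ⟨θ, hθ, fun z hz => ?_⟩
  set w := fun m => (twoStep η)^[m] z with hw
  set b := fun m => w m 3 * (1 - w m 3) with hb
  have hcube : ∀ m, w m ∈ cube := iterate_twoStep_mem_cube η hz.mem_cube
  have hb0 : ∀ m, 0 ≤ b m := fun m =>
    mul_nonneg (hcube m 3).1 (by linarith [(hcube m 3).2])
  have hsum0 : ∀ m, 0 ≤ ∑ j ∈ Finset.range m, b j := fun m => Finset.sum_nonneg fun j _ => hb0 j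
  have hle : ∀ m, θ * Real.exp (-(c * ∑ j ∈ Finset.range m, b j)) ≤ θ := fun m =>
    mul_le_of_le_one_right hθ.le (Real.exp_le_one_iff.2 (by nlinarith [hsum0 m]))
  -- The contraction factors multiply, so the odds are controlled by the partial sums of `b`;
  -- summability of `b` decides which player goes to the boundary.
  have key : ∀ m, NearFace η (θ * Real.exp (-(c * ∑ j ∈ Finset.range m, b j))) (w m) := by
    intro m
    induction m with
    | zero => simpa [hw] using hz
    | succ m ih =>
      have h1 := (H _ (hle m) _ ih).1
      rw [mul_assoc, ← Real.exp_add] at h1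
      rw [Finset.sum_range_succ]
      have h2 : w (m + 1) = twoStep η (w m) := Function.iterate_succ_apply' _ _ _
      rw [h2]
      convert h1 using 3
      simp only [hb]
      ring
  by_cases hs : Summable b
  · right
    set K := Real.exp (10 * η * Real.exp (3 * η) * θ) - 1 with hK
    have hdist : ∀ m, dist (w m 3) (w (m + 1) 3) ≤ b m * K := by
      intro m
      obtain ⟨s, hs, h3⟩ := (H θ le_rfl _ ((key m).mono (hle m))).2
      have h2 : w (m + 1) = twoStep η (w m) := Function.iterate_succ_apply' _ _ _
      rw [h2, h3, dist_comm, Real.dist_eq]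
      refine (abs_tilt_sub_self_le (hcube m 3) s).trans (mul_le_mul_of_nonneg_left ?_ (hb0 m))
      exact sub_le_sub_right (Real.exp_le_exp.2 hs) 1
    have hcau := cauchySeq_of_dist_le_of_summable _ hdist (hs.mul_right K)
    obtain ⟨l, hl⟩ := cauchySeq_tendsto_of_complete hcau
    have hb1 : Tendsto b atTop (𝓝 0) := hs.tendsto_atTop_zero
    have hb2 : Tendsto b atTop (𝓝 (l * (1 - l))) := hl.mul (hl.const_sub 1)
    refine ⟨l, ?_, ?_, hl⟩
    · rcases mul_eq_zero.1 (tendsto_nhds_unique hb2 hb1) with h | h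
      · exact Or.inl h
      · exact Or.inr (by linarith)
    -- The opponent's two consecutive entries differ by a tilt of bounded size, hence by `O(b m)`,
    -- and so share the limit.
    · have hd : Tendsto (fun m => w m 2 - w m 3) atTop (𝓝 0) := by
        refine squeeze_zero_norm (a := fun m => b m * (Real.exp (3 * η) - 1)) (fun m => ?_)
          (by simpa using hb1.mul_const (Real.exp (3 * η) - 1))
        obtain ⟨e, he, h2⟩ := (key m).exists_prev
        rw [h2, Real.norm_eq_abs]
        refine (abs_tilt_sub_self_le (hcube m 3) _).trans (mul_le_mul_of_nonneg_left ?_ (hb0 m))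
        refine sub_le_sub_right (Real.exp_le_exp.2 (abs_le.2 ⟨?_, ?_⟩)) 1 <;>
          linarith [he.1, he.2]
      simpa using hd.add hl
  · left
    refine tendsto_of_nearFace key ?_
    have h1 := (not_summable_iff_tendsto_nat_atTop_of_nonneg hb0).1 hs
    have h2 := Real.tendsto_exp_neg_atTop_nhds_zero.comp (h1.const_mul_atTop hc)
    simpa using h2.const_mul θ

/-! ### The Jacobian at the fixed points. -/

theorem differentiableAt_tilt {f g : (Fin 4 → ℝ) → ℝ} {z : Fin 4 → ℝ}
    (hf : DifferentiableAt ℝ f z) (hg : DifferentiableAt ℝ g z)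
    (h : f z * Real.exp (g z) + (1 - f z) ≠ 0) :
    DifferentiableAt ℝ (fun z => tilt (f z) (g z)) z := by
  simp only [tilt, div_eq_mul_inv]
  have hd : DifferentiableAt ℝ (fun z => f z * Real.exp (g z) + (1 - f z)) z := by fun_prop
  have hn : DifferentiableAt ℝ (fun z => f z * Real.exp (g z)) z := by fun_prop
  exact hn.mul (hd.inv h)

theorem differentiableAt_G₁ {η : ℝ} {z : Fin 4 → ℝ} (hz : Regular₁ η z) :
    DifferentiableAt ℝ (G₁ η) z := by
  rw [funext (G₁_eq η), differentiableAt_pi]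
  intro k
  fin_cases k
  · exact differentiableAt_apply 1 z
  · exact differentiableAt_tilt (by fun_prop) (by fun_prop) hz.1
  · exact differentiableAt_apply 3 z
  · exact differentiableAt_tilt (by fun_prop) (by fun_prop) hz.2

theorem differentiableAt_G₂ {η : ℝ} {z : Fin 4 → ℝ} (hz : Regular₂ η z) :
    DifferentiableAt ℝ (G₂ η) z := by
  rw [funext (G₂_eq η), differentiableAt_pi]
  intro k
  fin_cases k
  · exact differentiableAt_apply 1 z
  · exact differentiableAt_tilt (by fun_prop) (by fun_prop) hz.1
  · exact differentiableAt_apply 3 z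
  · exact differentiableAt_tilt (by fun_prop) (by fun_prop) hz.2

theorem differentiableAt_twoStep (η : ℝ) {z : Fin 4 → ℝ} (hz : z ∈ cube) :
    DifferentiableAt ℝ (twoStep η) z :=
  (differentiableAt_G₁ (regular₁_of_mem_cube η (G₂_mem_cube η hz))).comp z
    (differentiableAt_G₂ (regular₂_of_mem_cube η hz))

theorem isOpen_regular₁ (η : ℝ) : IsOpen {z | Regular₁ η z} := by
  refine IsOpen.inter (isOpen_ne_fun ?_ ?_) (isOpen_ne_fun ?_ ?_) <;> fun_prop

theorem isOpen_regular₂ (η : ℝ) : IsOpen {z | Regular₂ η z} := by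
  refine IsOpen.inter (isOpen_ne_fun ?_ ?_) (isOpen_ne_fun ?_ ?_) <;> fun_prop

/-- Fixed points lie on the boundary of the cube, so equivariance is required outside it as well.
Nonvanishing of the denominators is an open condition and supplies the neighborhood. -/
theorem eventually_twoStep_toFace (η : ℝ) (i s : Fin 2) {z : Fin 4 → ℝ} (hz : z ∈ cube) :
    ∀ᶠ w in 𝓝 z, twoStep η (toFace i s w) = toFace i s (twoStep η w) := by
  have h2 := regular₂_of_mem_cube η hz
  have h1 := (differentiableAt_G₂ h2).continuousAt.eventually
    ((isOpen_regular₁ η).mem_nhds (regular₁_of_mem_cube η (G₂_mem_cube η hz)))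
  filter_upwards [(isOpen_regular₂ η).mem_nhds h2, h1] with w hw2 hw1
  simp only [twoStep, Function.comp_apply]
  rw [G₂_toFace η i s hw2, G₁_toFace η i s hw1]

theorem differentiable_toFace (i s : Fin 2) : Differentiable ℝ (toFace i s) := by
  rw [differentiable_pi]
  intro k
  fin_cases i <;> fin_cases s <;> fin_cases k <;> simp [toFace] <;> fun_prop

theorem differentiable_ofFace (i s : Fin 2) : Differentiable ℝ (ofFace i s) := by
  rw [differentiable_pi]
  intro k
  fin_cases i <;> fin_cases s <;> fin_cases k <;> simp [ofFace] <;> fun_prop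

/-- Locally `f = S ∘ f ∘ T`. Since `T z` is fixed, the outer derivative of `S` is also taken at `T
z`, where it inverts that of `T`; the two Jacobians are therefore similar. -/
theorem charpoly_jacobian_of_conj {f T S : (Fin 4 → ℝ) → Fin 4 → ℝ} {z : Fin 4 → ℝ}
    (hT : Differentiable ℝ T) (hS : Differentiable ℝ S) (hTS : ∀ w, T (S w) = w)
    (hST : ∀ w, S (T w) = w) (hf : DifferentiableAt ℝ f (T z)) (hfix : f (T z) = T z)
    (h : ∀ᶠ w in 𝓝 z, f (T w) = T (f w)) :
    (jacobian f z).charpoly = (jacobian f (T z)).charpoly := by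
  have hS' := (hS (T z)).hasFDerivAt
  have hT' := (hT z).hasFDerivAt
  have h1 : HasFDerivAt f
      ((fderiv ℝ S (T z)).comp ((fderiv ℝ f (T z)).comp (fderiv ℝ T z))) z := by
    have h2 : HasFDerivAt (fun w => S (f (T w)))
        ((fderiv ℝ S (T z)).comp ((fderiv ℝ f (T z)).comp (fderiv ℝ T z))) z := by
      refine HasFDerivAt.comp z ?_ (hf.hasFDerivAt.comp z hT')
      simpa only [hfix, Function.comp_apply] using hS'
    refine h2.congr_of_eventuallyEq ?_
    filter_upwards [h] with w hw
    rw [hw, hST]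
  have h3 : (fderiv ℝ T z).comp (fderiv ℝ S (T z)) = ContinuousLinearMap.id ℝ _ := by
    have h4 : HasFDerivAt (fun w => T (S w)) ((fderiv ℝ T z).comp (fderiv ℝ S (T z))) (T z) := by
      refine HasFDerivAt.comp (T z) ?_ hS'
      simpa only [hST] using hT'
    simp only [hTS] at h4
    exact h4.unique (hasFDerivAt_id _)
  have h5 : LinearMap.toMatrix' (fderiv ℝ T z : (Fin 4 → ℝ) →ₗ[ℝ] (Fin 4 → ℝ)) *
      LinearMap.toMatrix' (fderiv ℝ S (T z) : (Fin 4 → ℝ) →ₗ[ℝ] (Fin 4 → ℝ)) = 1 := by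
    rw [← LinearMap.toMatrix'_comp, ← ContinuousLinearMap.toLinearMap_comp, h3]
    exact LinearMap.toMatrix'_id
  rw [jacobian, h1.fderiv, ContinuousLinearMap.toLinearMap_comp,
    ContinuousLinearMap.toLinearMap_comp, LinearMap.toMatrix'_comp, LinearMap.toMatrix'_comp,
    Matrix.charpoly_mul_comm, mul_assoc, h5, mul_one, jacobian]

theorem jacobian_apply_eq {f : (Fin 4 → ℝ) → Fin 4 → ℝ} {z : Fin 4 → ℝ} {k j : Fin 4} {d : ℝ}
    (hf : DifferentiableAt ℝ f z)
    (h : HasDerivAt (fun t => f (Function.update z j (z j + t)) k) d 0) :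
    jacobian f z k j = d := by
  have h1 := hf.hasFDerivAt.hasLineDerivAt (Pi.single j 1)
  have h2 := (hasDerivAt_pi.1 h1) k
  have h3 : ∀ t : ℝ, z + t • Pi.single j (1 : ℝ) = Function.update z j (z j + t) := by
    intro t
    ext l
    by_cases hl : l = j
    · subst hl; simp
    · simp [hl]
  simp only [h3] at h2
  rw [jacobian, LinearMap.toMatrix'_apply]
  exact h2.unique h

/-- The tilt is `p` times a continuous factor, and at a zero of `p` the product rule needs no
derivative of that factor. Mere continuity of the exponent suffices, which spares differentiating
the nested tilt. -/
theorem hasDerivAt_tilt_of_eq_zero {p e : ℝ → ℝ} {p' x : ℝ} (hp : HasDerivAt p p' x)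
    (h0 : p x = 0) (he : ContinuousAt e x) :
    HasDerivAt (fun t => tilt (p t) (e t)) (p' * Real.exp (e x)) x := by
  have hh : Tendsto (fun t => Real.exp (e t) / (p t * Real.exp (e t) + (1 - p t))) (𝓝[≠] x)
      (𝓝 (Real.exp (e x))) := by
    have : ContinuousAt (fun t => Real.exp (e t) / (p t * Real.exp (e t) + (1 - p t))) x :=
      he.rexp.div ((hp.continuousAt.mul he.rexp).add (continuousAt_const.sub hp.continuousAt))
        (by simp [h0])
    have h1 := this.tendsto
    simp only [h0, zero_mul, sub_zero, zero_add, div_one] at h1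
    exact h1.mono_left nhdsWithin_le_nhds
  rw [hasDerivAt_iff_tendsto_slope] at hp ⊢
  refine (hp.mul hh).congr fun t => ?_
  simp only [slope, h0, vsub_eq_sub, sub_zero, smul_eq_mul, tilt]
  ring

/-- In the coordinate order `1, 0, 3, 2` the matrix is lower triangular, so the six remaining
entries are irrelevant. -/
theorem charpoly_of_entries {M : Matrix (Fin 4) (Fin 4) ℝ} {l : ℝ} (h00 : M 0 0 = 0)
    (h02 : M 0 2 = 0) (h03 : M 0 3 = 0) (h10 : M 1 0 = 0) (h11 : M 1 1 = l) (h12 : M 1 2 = 0)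
    (h13 : M 1 3 = 0) (h22 : M 2 2 = 0) (h32 : M 3 2 = 0) (h33 : M 3 3 = 1) :
    M.charpoly = X ^ 2 * (X - 1) * (X - C l) := by
  have hM : M = !![0, M 0 1, 0, 0; 0, l, 0, 0; M 2 0, M 2 1, 0, M 2 3; M 3 0, M 3 1, 0, 1] := by
    ext a b
    fin_cases a <;> fin_cases b <;> simp [*]
  rw [hM, Matrix.charpoly, Matrix.det_succ_row_zero]
  simp [Fin.sum_univ_succ, Matrix.det_fin_three, Matrix.charmatrix_apply, Fin.succAbove,
    Matrix.submatrix_apply, Matrix.diagonal_apply]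
  ring

theorem twoStep_zero_of_eq_zero (η : ℝ) {z : Fin 4 → ℝ} (hz : z 1 = 0) : twoStep η z 0 = 0 := by
  rw [twoStep_eq η z rfl rfl]
  simp [hz]

theorem twoStep_one_of_eq_zero (η : ℝ) {z : Fin 4 → ℝ} (hz : z 1 = 0) : twoStep η z 1 = 0 := by
  rw [twoStep_eq η z rfl rfl]
  simp [hz]

/-- The right-hand exponent is the two-step change of the first player's log-odds at the fixed
point, the form in which the derivative computation produces the eigenvalue. -/
theorem fourthEigenvalue_eq (η : ℝ) {a : ℝ} (ha : a ∈ Set.Icc (0 : ℝ) 1) :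
    fourthEigenvalue η a = Real.exp (2 * η * (shift η a - a)) := by
  have h := tilt_den_pos ha (-(3 * η))
  rw [fourthEigenvalue, shift_eq, tilt_sub_self ha]
  congr 1
  have h3 : Real.exp (3 * η) * Real.exp (-(3 * η)) = 1 := by rw [← Real.exp_add]; simp
  have h4 : a + (1 - a) * Real.exp (3 * η) =
      Real.exp (3 * η) * (a * Real.exp (-(3 * η)) + (1 - a)) := by
    linear_combination (-a) * h3
  have h5 : Real.exp (-(3 * η)) - 1 = -(Real.exp (3 * η) - 1) / Real.exp (3 * η) := by
    rw [eq_div_iff (Real.exp_pos _).ne']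
    linear_combination h3
  rw [h4, h5]
  field_simp

theorem fourthEigenvalue_lt_one {η : ℝ} (hη : 0 < η) {a : ℝ} (ha : a ∈ Set.Ioo (0 : ℝ) 1) :
    fourthEigenvalue η a < 1 := by
  have h1 : 0 < 1 - a := by linarith [ha.2]
  have h0 := ha.1
  have h2 : 0 < Real.exp (3 * η) - 1 := sub_pos.2 (Real.one_lt_exp_iff.2 (by linarith))
  rw [fourthEigenvalue, Real.exp_lt_one_iff, neg_lt_zero]
  positivity

/-- Invariance of `z 1 = 0` kills the first two rows away from column `1`. On the face the image
does not depend on `z 2`, which kills column `2`, and it restores `z 3`, which gives the eigenvalue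
`1`. -/
theorem charpoly_jacobian_basePoint (η : ℝ) {a : ℝ} (ha : a ∈ Set.Ioo (0 : ℝ) 1) :
    (jacobian (twoStep η) ![0, 0, a, shift η a]).charpoly =
      X ^ 2 * (X - 1) * (X - C (fourthEigenvalue η a)) := by
  have ha' := Set.Ioo_subset_Icc_self ha
  have hdiff := differentiableAt_twoStep η (basePoint_mem_cube η ha')
  have hs : shift η a ∈ Set.Ioo (0 : ℝ) 1 := by rw [shift_eq]; exact tilt_mem_Ioo ha _
  have hrow : ∀ k : Fin 4, ∀ c : ℝ → Fin 4 → ℝ, (∀ t, twoStep η (c t) k = 0) →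
      HasDerivAt (fun t => twoStep η (c t) k) 0 0 := by
    intro k c h
    simp only [h]
    exact hasDerivAt_const _ _
  have hcol : ∀ k : Fin 4, HasDerivAt (fun t => twoStep η (Function.update
      ![0, 0, a, shift η a] 2 (![0, 0, a, shift η a] 2 + t)) k) 0 0 := by
    intro k
    have : ∀ t : ℝ, Function.update ![0, 0, a, shift η a] 2 (![0, 0, a, shift η a] 2 + t) =
        ![0, 0, a + t, shift η a] := by
      intro t; ext l; fin_cases l <;> simp [Function.update]
    simp only [this, twoStep_of_face η _ (Set.Ioo_subset_Icc_self hs)]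
    exact hasDerivAt_const _ _
  have hz : ∀ j : Fin 4, j ≠ 1 → ∀ t : ℝ, Function.update ![0, 0, a, shift η a] j
      (![0, 0, a, shift η a] j + t) 1 = 0 := by
    intro j hj t
    rw [Function.update_of_ne (Ne.symm hj)]
    rfl
  refine charpoly_of_entries
    (jacobian_apply_eq hdiff (hrow 0 _ fun t => twoStep_zero_of_eq_zero η (hz 0 (by decide) t)))
    (jacobian_apply_eq hdiff (hcol 0))
    (jacobian_apply_eq hdiff (hrow 0 _ fun t => twoStep_zero_of_eq_zero η (hz 3 (by decide) t)))
    (jacobian_apply_eq hdiff (hrow 1 _ fun t => twoStep_one_of_eq_zero η (hz 0 (by decide) t)))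
    (jacobian_apply_eq hdiff ?_)
    (jacobian_apply_eq hdiff (hcol 1))
    (jacobian_apply_eq hdiff (hrow 1 _ fun t => twoStep_one_of_eq_zero η (hz 3 (by decide) t)))
    (jacobian_apply_eq hdiff (hcol 2))
    (jacobian_apply_eq hdiff (hcol 3))
    (jacobian_apply_eq hdiff ?_)
  · have h1 : ∀ t : ℝ, Function.update ![0, 0, a, shift η a] 1 (![0, 0, a, shift η a] 1 + t) =
        ![0, t, a, shift η a] := by
      intro t; ext l; fin_cases l <;> simp [Function.update]
    have h2 : ∀ t : ℝ, twoStep η ![0, t, a, shift η a] 1 =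
        tilt (tilt t (-(3 * η) + 4 * η * shift η a + 2 * η * a))
          (3 * η - 4 * η * tilt (shift η a) (3 * η - 4 * η * t) - 2 * η * shift η a) := by
      intro t
      rw [twoStep_eq η _ rfl rfl]
      simp
    simp only [h1, h2]
    have h3 : HasDerivAt (fun t => tilt t (-(3 * η) + 4 * η * shift η a + 2 * η * a))
        (1 * Real.exp (-(3 * η) + 4 * η * shift η a + 2 * η * a)) 0 :=
      hasDerivAt_tilt_of_eq_zero (hasDerivAt_id 0) rfl continuousAt_const
    have h4 : ContinuousAt (fun t => 3 * η - 4 * η * tilt (shift η a) (3 * η - 4 * η * t)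
        - 2 * η * shift η a) 0 := by
      have : ContinuousAt (fun t => tilt (shift η a) (3 * η - 4 * η * t)) 0 := by
        unfold tilt
        refine ContinuousAt.div (by fun_prop) (by fun_prop) ?_
        exact (tilt_den_pos (Set.Ioo_subset_Icc_self hs) _).ne'
      fun_prop
    have h5 := hasDerivAt_tilt_of_eq_zero h3 (tilt_zero_left _) h4
    convert h5 using 1
    have h6 : tilt (shift η a) (3 * η - 4 * η * 0) = a := by
      rw [shift_eq, tilt_tilt ha']; ring_nf; simp
    rw [h6, fourthEigenvalue_eq η ha', one_mul, ← Real.exp_add]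
    ring_nf
  · have h1 : ∀ t : ℝ, Function.update ![0, 0, a, shift η a] 3 (![0, 0, a, shift η a] 3 + t) =
        ![0, 0, a, shift η a + t] := by
      intro t; ext l; fin_cases l <;> simp [Function.update]
    simp only [h1]
    refine HasDerivAt.congr_of_eventuallyEq (f := fun t => shift η a + t)
      ((hasDerivAt_id 0).const_add _) ?_
    have h2 : ContinuousAt (fun t : ℝ => shift η a + t) 0 := by fun_prop
    have h3 : ∀ᶠ t in 𝓝 (0 : ℝ), shift η a + t ∈ Set.Ioo (0 : ℝ) 1 :=
      h2.eventually (isOpen_Ioo.mem_nhds (by simpa using hs))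
    filter_upwards [h3] with t ht
    rw [twoStep_of_face η _ (Set.Ioo_subset_Icc_self ht)]
    rfl

theorem charpoly_jacobian_facePoint (η : ℝ) (i s : Fin 2) {a : ℝ} (ha : a ∈ Set.Ioo (0 : ℝ) 1) :
    (jacobian (twoStep η) (facePoint η i s a)).charpoly =
      X ^ 2 * (X - 1) * (X - C (fourthEigenvalue η a)) := by
  have ha' := Set.Ioo_subset_Icc_self ha
  have hc := facePoint_mem_cube η i s ha'
  have hd := differentiableAt_twoStep η (toFace_mem_cube i s hc)
  have hfix : twoStep η (toFace i s (facePoint η i s a)) = toFace i s (facePoint η i s a) := by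
    rw [twoStep_toFace η i s hc, isFixedPt_facePoint η i s ha']
  rw [charpoly_jacobian_of_conj (differentiable_toFace i s) (differentiable_ofFace i s)
    (toFace_ofFace i s) (ofFace_toFace i s) hd hfix (eventually_twoStep_toFace η i s hc),
    toFace_facePoint, charpoly_jacobian_basePoint η ha]

/-! ### Attraction from a neighborhood of a fixed point. -/

/-- Points near a fixed point in the relative interior of the face are attracted to the face. -/
theorem exists_tendsto_near_basePoint {η : ℝ} (hη : 0 < η) {a : ℝ} (ha : a ∈ Set.Ioo (0 : ℝ) 1) :
    ∃ ρ > 0, ∀ z ∈ cube, dist z ![0, 0, a, shift η a] < ρ →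
      Tendsto (fun m => (twoStep η)^[m] z 0) atTop (𝓝 0) ∧
      Tendsto (fun m => (twoStep η)^[m] z 1) atTop (𝓝 0) := by
  have ha' := Set.Ioo_subset_Icc_self ha
  have hs : shift η a ∈ Set.Ioo (0 : ℝ) 1 := by rw [shift_eq]; exact tilt_mem_Ioo ha _
  have hκ : 0 < shift η a * (1 - shift η a) := mul_pos hs.1 (by linarith [hs.2])
  obtain ⟨θ, hθ, H⟩ := exists_tendsto_of_interior hη (half_pos hκ)
  set b : Fin 4 → ℝ := ![0, 0, a, shift η a] with hb
  have hfix : twoStep η b = b := by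
    have h := isFixedPt_facePoint η 0 0 ha'
    exact h
  have hcont := (differentiableAt_twoStep η (basePoint_mem_cube η ha')).continuousAt
  have hk : ∀ k, ContinuousAt (fun z => twoStep η z k) b := fun k => continuousAt_pi.1 hcont k
  have h0 : ∀ᶠ z in 𝓝 b, twoStep η z 0 < 2 * Real.exp (3 * η) * θ :=
    (hk 0).eventually_lt_const (by beta_reduce; rw [hfix]; simp only [hb]; simp; positivity)
  have h1 : ∀ᶠ z in 𝓝 b, twoStep η z 1 < θ * (1 - twoStep η z 1) :=
    (hk 1).eventually_lt (continuousAt_const.mul (continuousAt_const.sub (hk 1)))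
      (by rw [hfix]; simp [hb, hθ])
  have h3 : ∀ᶠ z in 𝓝 b, shift η a * (1 - shift η a) / 2 < twoStep η z 3 * (1 - twoStep η z 3) := by
    have hc : ContinuousAt (fun z => twoStep η z 3 * (1 - twoStep η z 3)) b :=
      (hk 3).mul (continuousAt_const.sub (hk 3))
    refine hc.eventually_const_lt ?_
    beta_reduce
    rw [hfix]
    simp only [hb]
    simpa using hκ
  obtain ⟨ρ, hρ, hball⟩ := Metric.eventually_nhds_iff.1 (h0.and (h1.and h3))
  refine ⟨ρ, hρ, fun z hz hd => ?_⟩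
  obtain ⟨h0, h1, h3⟩ := hball hd
  -- An arbitrary point of the cube need not satisfy the link between its last two entries, but its
  -- image does. The contraction is therefore started at the image, which continuity keeps close to
  -- the fixed point.
  have hnear : NearFace η θ (twoStep η z) := by
    have hp := tilt_mem (hz 1) (-(3 * η) + 4 * η * z 3 + 2 * η * z 2)
    refine ⟨twoStep_mem_cube η hz, h1.le, h0.le,
      4 * η * tilt (z 1) (-(3 * η) + 4 * η * z 3 + 2 * η * z 2) + 2 * η * z 1, ⟨?_, ?_⟩, ?_⟩
    · have := hp.1; have := (hz 1).1; positivity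
    · nlinarith [hp.2, (hz 1).2]
    · rw [twoStep_eq η z rfl rfl]
      simp [add_assoc]
  obtain ⟨t0, t1⟩ := H _ hnear h3.le
  simp only [← Function.iterate_succ_apply] at t0 t1
  exact ⟨(tendsto_add_atTop_iff_nat (f := fun m => (twoStep η)^[m] z 0) 1).1 t0,
    (tendsto_add_atTop_iff_nat (f := fun m => (twoStep η)^[m] z 1) 1).1 t1⟩

/-! ### Trajectories of the algorithm as orbits of the two maps. -/

theorem mwStep_mem {w g : Fin 2 → ℝ} (hw : ∀ s, 0 < w s) :
    (∀ s, 0 < mwStep w g s) ∧ ∑ s, mwStep w g s = 1 := by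
  have h : 0 < ∑ r, w r * Real.exp (g r) :=
    Finset.sum_pos (fun r _ => mul_pos (hw r) (Real.exp_pos _)) Finset.univ_nonempty
  refine ⟨fun s => div_pos (mul_pos (hw s) (Real.exp_pos _)) h, ?_⟩
  simp only [mwStep]
  rw [← Finset.sum_div, div_self h.ne']

theorem mwStep_zero_eq_tilt {w g : Fin 2 → ℝ} (hw : w 1 = 1 - w 0) :
    mwStep w g 0 = tilt (w 0) (g 0 - g 1) := by
  rw [mwStep, Fin.sum_univ_two, hw, tilt_exp_exp]

section Trajectory

variable {η : ℝ} {x : ℤ → Fin 2 → Fin 2 → ℝ}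

theorem IsOMWU.pos_and_sum (h : IsOMWU η x) {t : ℤ} (ht : 0 ≤ t) :
    ∀ i, (∀ s, 0 < x t i s) ∧ ∑ s, x t i s = 1 := by
  induction t, ht using Int.leInduction with
  | base => exact fun i => ⟨h.init_pos i, (h.init_mem i).2⟩
  | succ t ht ih =>
    intro i
    fin_cases i
    · simp only [Fin.zero_eta, h.step_fst t ht]
      exact mwStep_mem (ih 0).1
    · simp only [Fin.mk_one, h.step_snd t ht]
      exact mwStep_mem (ih 1).1

theorem IsOMWU.pos (h : IsOMWU η x) {t : ℤ} (ht : 0 ≤ t) (i s : Fin 2) : 0 < x t i s :=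
  (h.pos_and_sum ht i).1 s

theorem IsOMWU.mem_stdSimplex (h : IsOMWU η x) {t : ℤ} (ht : -1 ≤ t) (i : Fin 2) :
    x t i ∈ stdSimplex ℝ (Fin 2) := by
  rcases ht.eq_or_lt with rfl | ht
  · exact h.prev_mem i
  · have := h.pos_and_sum (by omega : 0 ≤ t) i
    exact ⟨fun s => (this.1 s).le, this.2⟩

theorem IsOMWU.snd_eq (h : IsOMWU η x) {t : ℤ} (ht : -1 ≤ t) (i : Fin 2) :
    x t i 1 = 1 - x t i 0 := by
  have := (h.mem_stdSimplex ht i).2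
  rw [Fin.sum_univ_two] at this
  linarith

theorem IsOMWU.mem_Icc (h : IsOMWU η x) {t : ℤ} (ht : -1 ≤ t) (i s : Fin 2) :
    x t i s ∈ Set.Icc (0 : ℝ) 1 :=
  mem_Icc_of_mem_stdSimplex (h.mem_stdSimplex ht i) s

theorem IsOMWU.iterVec_mem_cube (h : IsOMWU η x) {n : ℤ} (hn : 0 ≤ n) : iterVec x n ∈ cube :=
  vec_mem_cube (h.mem_Icc (by omega) 0 0) (h.mem_Icc (by omega) 0 0) (h.mem_Icc (by omega) 1 0)
    (h.mem_Icc (by omega) 1 0)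

theorem IsOMWU.iterVec_succ_of_even (h : IsOMWU η x) {n : ℤ} (hn : 0 ≤ n) (he : Even n) :
    iterVec x (n + 1) = G₂ η (iterVec x n) := by
  have ho : ¬ Even (n - 1) := by
    rw [Int.not_even_iff_odd]; exact he.sub_odd odd_one
  have h0 := h.snd_eq (t := n) (by omega) 0
  have h1 := h.snd_eq (t := n) (by omega) 1
  have h0' := h.snd_eq (t := n - 1) (by omega) 0
  have h1' := h.snd_eq (t := n - 1) (by omega) 1
  rw [G₂_eq]
  simp only [iterVec, add_sub_cancel_right]
  rw [h.step_fst n hn, h.step_snd n hn, mwStep_zero_eq_tilt h0, mwStep_zero_eq_tilt h1]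
  simp [payoff, he, ho, Matrix.mulVec, dotProduct, Fin.sum_univ_two, h0, h1, h0', h1']
  constructor <;> ring_nf

theorem IsOMWU.iterVec_succ_of_odd (h : IsOMWU η x) {n : ℤ} (hn : 0 ≤ n) (ho : Odd n) :
    iterVec x (n + 1) = G₁ η (iterVec x n) := by
  have he : Even (n - 1) := ho.sub_odd odd_one
  have ho' : ¬ Even n := Int.not_even_iff_odd.2 ho
  have h0 := h.snd_eq (t := n) (by omega) 0
  have h1 := h.snd_eq (t := n) (by omega) 1
  have h0' := h.snd_eq (t := n - 1) (by omega) 0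
  have h1' := h.snd_eq (t := n - 1) (by omega) 1
  rw [G₁_eq]
  simp only [iterVec, add_sub_cancel_right]
  rw [h.step_fst n hn, h.step_snd n hn, mwStep_zero_eq_tilt h0, mwStep_zero_eq_tilt h1]
  simp [payoff, he, ho', Matrix.mulVec, dotProduct, Fin.sum_univ_two, h0, h1, h0', h1']
  constructor <;> ring_nf

theorem IsOMWU.iterVec_add_two (h : IsOMWU η x) {n : ℤ} (hn : 0 ≤ n) (he : Even n) :
    iterVec x (n + 2) = twoStep η (iterVec x n) := by
  have := h.iterVec_succ_of_odd (n := n + 1) (by omega) he.add_one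
  rw [h.iterVec_succ_of_even hn he, add_assoc] at this
  exact this

/-- The iterate vector in the coordinates of the face on which player `i` does not use
strategy `s`. -/
def faceVec (x : ℤ → Fin 2 → Fin 2 → ℝ) (i s : Fin 2) (n : ℤ) : Fin 4 → ℝ :=
  toFace i s (iterVec x n)

/-- The opponent's strategy index `s + i` is taken modulo `2` and records the twist of the
order-four symmetry. -/
theorem IsOMWU.faceVec_eq (h : IsOMWU η x) {n : ℤ} (hn : 0 ≤ n) (i s : Fin 2) :
    faceVec x i s n =
      ![x (n - 1) i s, x n i s, x (n - 1) (1 - i) (s + i), x n (1 - i) (s + i)] := by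
  have h0 := h.snd_eq (t := n) (by omega) 0
  have h1 := h.snd_eq (t := n) (by omega) 1
  have h0' := h.snd_eq (t := n - 1) (by omega) 0
  have h1' := h.snd_eq (t := n - 1) (by omega) 1
  fin_cases i <;> fin_cases s <;> simp [faceVec, toFace, iterVec, h0, h1, h0', h1']

theorem IsOMWU.faceVec_mem_cube (h : IsOMWU η x) {n : ℤ} (hn : 0 ≤ n) (i s : Fin 2) :
    faceVec x i s n ∈ cube :=
  toFace_mem_cube i s (h.iterVec_mem_cube hn)

theorem IsOMWU.faceVec_succ_of_even (h : IsOMWU η x) {n : ℤ} (hn : 0 ≤ n) (he : Even n)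
    (i s : Fin 2) : faceVec x i s (n + 1) = G₂ η (faceVec x i s n) := by
  rw [faceVec, h.iterVec_succ_of_even hn he, faceVec,
    G₂_toFace η i s (regular₂_of_mem_cube η (h.iterVec_mem_cube hn))]

theorem IsOMWU.faceVec_succ_of_odd (h : IsOMWU η x) {n : ℤ} (hn : 0 ≤ n) (ho : Odd n)
    (i s : Fin 2) : faceVec x i s (n + 1) = G₁ η (faceVec x i s n) := by
  rw [faceVec, h.iterVec_succ_of_odd hn ho, faceVec,
    G₁_toFace η i s (regular₁_of_mem_cube η (h.iterVec_mem_cube hn))]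

theorem IsOMWU.faceVec_add_two_mul (h : IsOMWU η x) {n : ℤ} (hn : 0 ≤ n) (he : Even n)
    (i s : Fin 2) (m : ℕ) : faceVec x i s (n + 2 * m) = (twoStep η)^[m] (faceVec x i s n) := by
  induction m with
  | zero => simp
  | succ m ih =>
    have h1 : n + 2 * ((m + 1 : ℕ) : ℤ) = n + 2 * m + 2 := by push_cast; ring
    rw [h1, faceVec, h.iterVec_add_two (by omega) (he.add (even_two_mul _)),
      ← twoStep_toFace η i s (h.iterVec_mem_cube (by omega)), ← faceVec, ih,
      Function.iterate_succ_apply']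

/-- In one step the log-odds of both players change by at most `3 η`. -/
theorem IsOMWU.exists_tilt_succ (h : IsOMWU η x) (hη : 0 < η) {n : ℤ} (hn : 0 ≤ n) (i s : Fin 2) :
    (∃ d, |d| ≤ 3 * η ∧ faceVec x i s (n + 1) 1 = tilt (faceVec x i s n 1) d) ∧
    (∃ d, |d| ≤ 3 * η ∧ faceVec x i s (n + 1) 3 = tilt (faceVec x i s n 3) d) := by
  have hc := h.faceVec_mem_cube hn i s
  have hb : ∀ u v : ℝ, u ∈ Set.Icc (0 : ℝ) 1 → v ∈ Set.Icc (0 : ℝ) 1 →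
      |-(3 * η) + 4 * η * u + 2 * η * v| ≤ 3 * η ∧ |3 * η - 4 * η * u - 2 * η * v| ≤ 3 * η := by
    intro u v hu hv
    have h1 := mul_nonneg hη.le hu.1
    have h2 := mul_nonneg hη.le hv.1
    have h3 := mul_le_of_le_one_right hη.le hu.2
    have h4 := mul_le_of_le_one_right hη.le hv.2
    constructor <;> rw [abs_le] <;> constructor <;> linarith
  rcases Int.even_or_odd n with he | ho
  · rw [h.faceVec_succ_of_even hn he, G₂_eq]
    exact ⟨⟨_, (hb _ _ (hc 3) (hc 2)).1, rfl⟩, ⟨_, (hb _ _ (hc 1) (hc 0)).2, rfl⟩⟩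
  · rw [h.faceVec_succ_of_odd hn ho, G₁_eq]
    exact ⟨⟨_, (hb _ _ (hc 3) (hc 2)).2, rfl⟩, ⟨_, (hb _ _ (hc 1) (hc 0)).1, rfl⟩⟩

theorem IsOMWU.exists_tilt_add (h : IsOMWU η x) (hη : 0 < η) {n : ℤ} (hn : 0 ≤ n) (i s : Fin 2)
    (k : ℕ) :
    (∃ d, |d| ≤ 3 * η * k ∧ faceVec x i s (n + k) 1 = tilt (faceVec x i s n 1) d) ∧
    (∃ d, |d| ≤ 3 * η * k ∧ faceVec x i s (n + k) 3 = tilt (faceVec x i s n 3) d) := by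
  induction k with
  | zero => exact ⟨⟨0, by simp, by simp⟩, ⟨0, by simp, by simp⟩⟩
  | succ k ih =>
    obtain ⟨⟨d, hd, e⟩, ⟨d', hd', e'⟩⟩ := ih
    obtain ⟨⟨c, hc, f⟩, ⟨c', hc', f'⟩⟩ := h.exists_tilt_succ hη (n := n + k) (by omega) i s
    have hcube := h.faceVec_mem_cube hn i s
    push_cast
    rw [← add_assoc]
    refine ⟨⟨d + c, (abs_add_le _ _).trans (by linarith), ?_⟩,
      ⟨d' + c', (abs_add_le _ _).trans (by linarith), ?_⟩⟩
    · rw [f, e, tilt_tilt (hcube 1)]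
    · rw [f', e', tilt_tilt (hcube 3)]

theorem IsOMWU.faceVec_prev (h : IsOMWU η x) {n : ℤ} (hn : 1 ≤ n) (i s : Fin 2) :
    faceVec x i s n 0 = faceVec x i s (n - 1) 1 ∧ faceVec x i s n 2 = faceVec x i s (n - 1) 3 := by
  rw [h.faceVec_eq (by omega), h.faceVec_eq (by omega)]
  exact ⟨rfl, rfl⟩

/-- The step into an even time is made by `G₁`, whose exponent for the opponent is `-(3 * η)` plus a
nonnegative term that is small near the face. -/
theorem IsOMWU.faceVec_linked (h : IsOMWU η x) {n : ℤ} (hn : 1 ≤ n) (he : Even n) (i s : Fin 2) :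
    faceVec x i s n 3 = tilt (faceVec x i s n 2)
      (-(3 * η) + (4 * η * faceVec x i s (n - 1) 1 + 2 * η * faceVec x i s (n - 1) 0)) := by
  have h1 := h.faceVec_succ_of_odd (n := n - 1) (by omega) (he.sub_odd odd_one) i s
  rw [sub_add_cancel, G₁_eq] at h1
  rw [h1]
  simp [add_assoc]

/-- Once player `i` gives little weight to `s`, there is an even time, soon after, at which the
iterate vector is near the face. -/
theorem IsOMWU.exists_nearFace (h : IsOMWU η x) (hη : 0 < η) {n : ℤ} (hn : 0 ≤ n) (i s : Fin 2)
    {θ : ℝ} (hθ : x n i s ≤ θ * (1 - x n i s)) :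
    ∃ N : ℤ, 0 ≤ N ∧ Even N ∧ NearFace η (θ * Real.exp (9 * η)) (faceVec x i s N) ∧
      ∃ d, |d| ≤ 9 * η ∧ faceVec x i s N 3 = tilt (faceVec x i s n 3) d := by
  have hcube := h.faceVec_mem_cube hn i s
  have hx : faceVec x i s n 1 = x n i s := by rw [h.faceVec_eq hn]; rfl
  have hθ0 : 0 ≤ θ := by
    by_contra! hneg
    have h1 := (h.mem_Icc (t := n) (by omega) i s).2
    have h2 := h.pos hn i s
    nlinarith [mul_nonpos_of_nonpos_of_nonneg hneg.le (sub_nonneg.2 h1)]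
  -- The even time `N = n + k + 1` is chosen so that `N - 1` and `N` both come after `n`, by at most
  -- three steps. The bound at time `n` then controls both entries, with log-odds moving by at most
  -- `9 * η`.
  obtain ⟨k, hk1, hk2, hk⟩ : ∃ k : ℕ, 1 ≤ k ∧ k ≤ 2 ∧ Even (n + ((k : ℤ) + 1)) := by
    rcases Int.even_or_odd n with he | ho
    · exact ⟨1, le_rfl, by omega, by simpa using he.add even_two⟩
    · refine ⟨2, by omega, le_rfl, ?_⟩
      have : Odd (((2 : ℕ) : ℤ) + 1) := by decide
      exact ho.add_odd this
  have hk2' : (k : ℝ) ≤ 2 := by exact_mod_cast hk2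
  have hodds : ∀ d, d ≤ 9 * η → tilt (faceVec x i s n 1) d ≤
      θ * Real.exp (9 * η) * (1 - tilt (faceVec x i s n 1) d) := fun d hd =>
    tilt_le_of_odds_le (hcube 1) hd (by rw [hx]; exact hθ)
  obtain ⟨⟨d, hd, e⟩, -⟩ := h.exists_tilt_add hη hn i s k
  obtain ⟨⟨c, hc, f⟩, ⟨c', hc', f'⟩⟩ := h.exists_tilt_add hη hn i s (k + 1)
  push_cast at hc hc' f f'
  have hm := h.faceVec_mem_cube (n := n + (k + 1)) (by omega) i s
  have hprev := h.faceVec_prev (n := n + (k + 1)) (by omega) i s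
  have hm' := h.faceVec_mem_cube (n := n + k) (by omega) i s
  have hsub : n + ((k : ℤ) + 1) - 1 = n + k := by ring
  have hlink := h.faceVec_linked (n := n + (k + 1)) (by omega) hk i s
  rw [hsub] at hprev hlink
  have hkη : 3 * η * ((k : ℝ) + 1) ≤ 9 * η := by nlinarith
  refine ⟨n + (k + 1), by omega, hk, ⟨hm, ?_, ?_, _, ⟨?_, ?_⟩, hlink⟩, c', hc'.trans hkη, f'⟩
  · rw [f]
    exact hodds c ((le_abs_self c).trans (hc.trans hkη))
  · rw [hprev.1, e]
    have h1 := hodds d ((le_abs_self d).trans (hd.trans (by nlinarith)))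
    have h2 := tilt_mem (hcube 1) d
    have h3 : 1 ≤ Real.exp (3 * η) := Real.one_le_exp (by linarith)
    have h4 : 0 ≤ θ * Real.exp (9 * η) := by positivity
    nlinarith [mul_nonneg h4 h2.1, mul_le_mul_of_nonneg_right h3 h4]
  · have := (hm' 1).1; have := (hm' 0).1; positivity
  · nlinarith [(hm' 1).2, (hm' 0).2]

end Trajectory

/-! ### Limits along trajectories and divergence from the equilibrium. -/

theorem tendsto_int_of_even_odd {f : ℤ → ℝ} {l : ℝ} {N : ℤ}
    (h0 : Tendsto (fun m : ℕ => f (N + 2 * m - 1)) atTop (𝓝 l))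
    (h1 : Tendsto (fun m : ℕ => f (N + 2 * m)) atTop (𝓝 l)) : Tendsto f atTop (𝓝 l) := by
  rw [tendsto_def] at h0 h1 ⊢
  intro s hs
  obtain ⟨a, ha⟩ := mem_atTop_sets.1 (h0 s hs)
  obtain ⟨b, hb⟩ := mem_atTop_sets.1 (h1 s hs)
  refine mem_atTop_sets.2 ⟨N + 2 * (a + b), fun t ht => ?_⟩
  rcases Int.even_or_odd' (t - N) with ⟨k, hk | hk⟩
  · lift k to ℕ using by omega
    have := hb k (by omega)
    rw [Set.mem_preimage] at this
    rwa [show N + 2 * (k : ℤ) = t by omega] at this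
  · lift k to ℕ using by omega
    have := ha (k + 1) (by omega)
    rw [Set.mem_preimage] at this
    rwa [show N + 2 * ((k + 1 : ℕ) : ℤ) - 1 = t by push_cast; omega] at this

theorem IsOMWU.tendsto_of_faceVec {η : ℝ} {x : ℤ → Fin 2 → Fin 2 → ℝ} (h : IsOMWU η x) {N : ℤ}
    (hN : 0 ≤ N) (he : Even N) (i s : Fin 2) {l : ℝ}
    (h0 : Tendsto (fun m => (twoStep η)^[m] (faceVec x i s N) 0) atTop (𝓝 l))
    (h1 : Tendsto (fun m => (twoStep η)^[m] (faceVec x i s N) 1) atTop (𝓝 l)) :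
    Tendsto (fun t => x t i s) atTop (𝓝 l) := by
  simp only [← h.faceVec_add_two_mul hN he i s] at h0 h1
  refine tendsto_int_of_even_odd (N := N) (h0.congr fun m => ?_) (h1.congr fun m => ?_) <;>
  · rw [h.faceVec_eq (by omega)]; rfl

theorem IsOMWU.tendsto_opponent_of_faceVec {η : ℝ} {x : ℤ → Fin 2 → Fin 2 → ℝ} (h : IsOMWU η x)
    {N : ℤ} (hN : 0 ≤ N) (he : Even N) (i s : Fin 2) {l : ℝ}
    (h2 : Tendsto (fun m => (twoStep η)^[m] (faceVec x i s N) 2) atTop (𝓝 l))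
    (h3 : Tendsto (fun m => (twoStep η)^[m] (faceVec x i s N) 3) atTop (𝓝 l)) :
    Tendsto (fun t => x t (1 - i) (s + i)) atTop (𝓝 l) := by
  simp only [← h.faceVec_add_two_mul hN he i s] at h2 h3
  refine tendsto_int_of_even_odd (N := N) (h2.congr fun m => ?_) (h3.congr fun m => ?_) <;>
  · rw [h.faceVec_eq (by omega)]; rfl

/-- If some probability tends to `0`, the divergence from the equilibrium tends to infinity. -/
theorem IsOMWU.tendsto_KL {η : ℝ} {x : ℤ → Fin 2 → Fin 2 → ℝ} (h : IsOMWU η x) {i s : Fin 2}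
    (h0 : Tendsto (fun t => x t i s) atTop (𝓝 0)) :
    Tendsto (fun t => KL equilibrium (x t)) atTop atTop := by
  have hev : ∀ᶠ t : ℤ in atTop, 0 ≤ t := eventually_ge_atTop 0
  have hw : Tendsto (fun t => x t i s) atTop (𝓝[>] 0) :=
    tendsto_nhdsWithin_iff.2 ⟨h0, hev.mono fun t ht => h.pos ht i s⟩
  -- This minorant keeps one of the four nonnegative terms `-log`; the constant collects the four
  -- terms `1 / 2 * log (1 / 2)`.
  have hlog : Tendsto (fun t => 1 / 2 * -Real.log (x t i s) + 2 * Real.log (1 / 2))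
      atTop atTop := by
    refine tendsto_atTop_add_const_right _ _ (Tendsto.const_mul_atTop (by norm_num) ?_)
    exact tendsto_neg_atBot_atTop.comp (Real.tendsto_log_nhdsGT_zero.comp hw)
  refine tendsto_atTop_mono' _ ?_ hlog
  filter_upwards [hev] with t ht
  have hterm : ∀ j r, 0 ≤ -Real.log (x t j r) := fun j r =>
    neg_nonneg.2 (Real.log_nonpos (h.pos ht j r).le (h.mem_Icc (by omega) j r).2)
  have hKL : KL equilibrium (x t) = 2 * Real.log (1 / 2) +
      1 / 2 * ∑ j, ∑ r, -Real.log (x t j r) := by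
    have hd : ∀ j r, Real.log (1 / 2 / x t j r) = Real.log (1 / 2) - Real.log (x t j r) :=
      fun j r => Real.log_div (by norm_num) (h.pos ht j r).ne'
    simp only [KL, equilibrium, hd, Fin.sum_univ_two]
    ring
  have hle : -Real.log (x t i s) ≤ ∑ j, ∑ r, -Real.log (x t j r) :=
    (Finset.single_le_sum (f := fun r => -Real.log (x t i r)) (fun r _ => hterm i r)
      (Finset.mem_univ s)).trans
    (Finset.single_le_sum (f := fun j => ∑ r, -Real.log (x t j r))
      (fun j _ => Finset.sum_nonneg fun r _ => hterm j r) (Finset.mem_univ i))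
  rw [hKL]
  linarith

theorem le_odds_of_lt {p δ : ℝ} (h0 : 0 ≤ p) (hδ : δ ≤ 1 / 2) (hp : p < δ) :
    p ≤ 2 * δ * (1 - p) := by
  nlinarith

/-- An iterate vector near the face is near one of the fixed points. -/
theorem exists_facePoint_near {η : ℝ} (hη : 0 < η) (i s : Fin 2) {ε : ℝ} (hε : 0 < ε) :
    ∃ δ > 0, ∀ x, IsOMWU η x → ∀ n : ℤ, 2 ≤ n → Even n → x (n - 1) i s < δ → x n i s < δ →
      ∃ a ∈ Set.Ioo (0 : ℝ) 1, dist (iterVec x n) (facePoint η i s a) < ε := by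
  have hlog : 0 < Real.log (1 + ε) := Real.log_pos (by linarith)
  set E := Real.exp (3 * η) with hE
  have hE1 : 1 ≤ E := Real.one_le_exp (by linarith)
  -- With `a` the opponent's entry at time `n - 1`, the third coordinate agrees exactly, and `ε`
  -- handles the first two. The last bound makes the exponent error in the fourth smaller than `log
  -- (1 + ε)`.
  refine ⟨min (1 / 2) (min ε (Real.log (1 + ε) / (16 * η * E))), by positivity, ?_⟩
  intro x h n hn he hx0 hx1
  set δ := min (1 / 2) (min ε (Real.log (1 + ε) / (16 * η * E))) with hδ
  have hδ1 : δ ≤ 1 / 2 := min_le_left _ _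
  have hδ2 : δ ≤ ε := (min_le_right _ _).trans (min_le_left _ _)
  have hδ3 : δ * (16 * η * E) ≤ Real.log (1 + ε) := by
    rw [← le_div_iff₀ (by positivity)]
    exact (min_le_right _ _).trans (min_le_right _ _)
  have hδ0 : 0 < δ := (h.pos (by omega) i s).trans hx1
  have hc1 := h.faceVec_mem_cube (n := n - 1) (by omega) i s
  have hc2 := h.faceVec_mem_cube (n := n - 2) (by omega) i s
  have hc := h.faceVec_mem_cube (n := n) (by omega) i s
  have e0 : faceVec x i s n 0 = x (n - 1) i s := by rw [h.faceVec_eq (by omega)]; rfl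
  have e1 : faceVec x i s n 1 = x n i s := by rw [h.faceVec_eq (by omega)]; rfl
  have e2 : faceVec x i s n 2 = x (n - 1) (1 - i) (s + i) := by
    rw [h.faceVec_eq (by omega)]; rfl
  obtain ⟨hp0, -⟩ := h.faceVec_prev (n := n) (by omega) i s
  obtain ⟨hp1, -⟩ := h.faceVec_prev (n := n - 1) (by omega) i s
  obtain ⟨⟨d, hd, hstep⟩, -⟩ := h.exists_tilt_succ hη (n := n - 2) (by omega) i s
  rw [show n - 2 + 1 = n - 1 by ring] at hstep
  rw [show n - 1 - 1 = n - 2 by ring] at hp1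
  -- The exponent error also involves time `n - 2`, where smallness is not assumed. Running one step
  -- backwards changes the log-odds by at most `3 * η`, and `2 ≤ n` ensures that this step belongs
  -- to the dynamics.
  have hback : faceVec x i s (n - 2) 1 = tilt (faceVec x i s (n - 1) 1) (-d) := by
    rw [hstep, tilt_tilt (hc2 1), add_neg_cancel, tilt_zero_right]
  have hsmall1 : faceVec x i s (n - 1) 1 < δ := by rw [← hp0, e0]; exact hx0
  have hsmall2 : faceVec x i s (n - 2) 1 ≤ 2 * δ * E := by
    have h1 := tilt_le_of_odds_le (hc1 1) (by linarith [neg_abs_le d] : -d ≤ 3 * η)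
      (le_odds_of_lt (hc1 1).1 hδ1 hsmall1)
    rw [← hback] at h1
    have : 0 ≤ 2 * δ * E := by positivity
    nlinarith [(hc2 1).1]
  have hlink := h.faceVec_linked (n := n) (by omega) he i s
  rw [hp1] at hlink
  set e := 4 * η * faceVec x i s (n - 1) 1 + 2 * η * faceVec x i s (n - 2) 1 with hedef
  have he0 : 0 ≤ e := by have := (hc1 1).1; have := (hc2 1).1; positivity
  have he1 : e < Real.log (1 + ε) := by
    have h1 := mul_le_mul_of_nonneg_left hsmall1.le hη.le
    have h2 := mul_le_mul_of_nonneg_left hsmall2 hη.le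
    have h3 := mul_le_mul_of_nonneg_left hE1 (mul_pos hη hδ0).le
    have h4 : 0 < η * δ * E := by positivity
    nlinarith
  have ha : faceVec x i s n 2 ∈ Set.Ioo (0 : ℝ) 1 := by
    rw [e2]
    have hsum := (h.pos_and_sum (t := n - 1) (by omega) (1 - i)).2
    have hpos := fun r => h.pos (t := n - 1) (by omega) (1 - i) r
    refine ⟨hpos _, ?_⟩
    rw [Fin.sum_univ_two] at hsum
    have h0 := hpos 0
    have h1 := hpos 1
    generalize s + i = r
    fin_cases r <;> simp <;> linarith
  refine ⟨_, ha, ?_⟩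
  rw [← dist_toFace i s, toFace_facePoint, ← faceVec, dist_pi_lt_iff hε]
  intro k
  fin_cases k
  · change dist (faceVec x i s n 0) 0 < ε
    rw [Real.dist_0_eq_abs, abs_of_nonneg (hc 0).1, e0]
    linarith
  · change dist (faceVec x i s n 1) 0 < ε
    rw [Real.dist_0_eq_abs, abs_of_nonneg (hc 1).1, e1]
    linarith
  · change dist (faceVec x i s n 2) (faceVec x i s n 2) < ε
    rwa [dist_self]
  · change dist (faceVec x i s n 3) (shift η (faceVec x i s n 2)) < ε
    have hm := tilt_mem (hc 2) (-(3 * η))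
    rw [hlink, shift_eq, ← tilt_tilt (hc 2), Real.dist_eq]
    refine (abs_tilt_sub_self_le hm e).trans_lt ?_
    rw [abs_of_nonneg he0]
    have h1 : Real.exp e < 1 + ε := by
      rw [← Real.exp_log (by linarith : 0 < 1 + ε)]
      exact Real.exp_lt_exp.2 he1
    have h2 : 1 ≤ Real.exp e := Real.one_le_exp he0
    have h3 := mul_one_sub_le_quarter (tilt (faceVec x i s n 2) (-(3 * η)))
    nlinarith

theorem exists_tendsto_near_facePoint {η : ℝ} (hη : 0 < η) (i s : Fin 2) {a : ℝ}
    (ha : a ∈ Set.Ioo (0 : ℝ) 1) :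
    ∃ ρ > 0, ∀ z : Fin 4 → ℝ, (∀ k, z k ∈ Set.Icc (0 : ℝ) 1) →
      dist z (facePoint η i s a) < ρ → ∀ r : Fin 2,
        Tendsto (fun t : ℕ => ((twoStep η)^[t] z) (coord i r)) atTop (𝓝 (![0, 1] s)) := by
  obtain ⟨ρ, hρ, H⟩ := exists_tendsto_near_basePoint hη ha
  refine ⟨ρ, hρ, fun z hz hd r => ?_⟩
  rw [← dist_toFace i s, toFace_facePoint] at hd
  obtain ⟨h0, h1⟩ := H _ (toFace_mem_cube i s hz) hd
  simp only [iterate_twoStep_toFace η i s hz] at h0 h1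
  have h0' := h0.const_sub 1
  have h1' := h1.const_sub 1
  fin_cases i <;> fin_cases s <;> fin_cases r <;> simp [toFace, coord] at * <;> assumption

theorem exists_tendsto_of_opponent_interior {η : ℝ} (hη : 0 < η) (i s : Fin 2) {κ : ℝ}
    (hκ : 0 < κ) :
    ∃ δ > 0, ∀ x, IsOMWU η x → ∀ n : ℤ, 0 ≤ n → x n i s < δ →
      (∀ j, j ≠ i → ∀ s', κ ≤ x n j s') → Tendsto (fun t : ℤ => x t i s) atTop (𝓝 0) := by
  have hE : 0 < Real.exp (-(9 * η)) := Real.exp_pos _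
  obtain ⟨θ, hθ, H⟩ := exists_tendsto_of_interior hη
    (mul_pos (mul_pos hκ hκ) hE : 0 < κ * κ * Real.exp (-(9 * η)))
  -- A probability below `δ ≤ 1 / 2` has odds at most `2 * δ`, and these grow by at most `exp (9 *
  -- η)` before time `N`.
  refine ⟨min (1 / 2) (θ * Real.exp (-(9 * η)) / 2), by positivity, ?_⟩
  intro x h n hn hx hopp
  have h2 := min_le_right (1 / 2) (θ * Real.exp (-(9 * η)) / 2)
  obtain ⟨N, hN, he, hnear, d, hd, htilt⟩ := h.exists_nearFace hη hn i s
    (le_odds_of_lt (h.pos hn i s).le (min_le_left _ _) hx)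
  have hee : Real.exp (-(9 * η)) * Real.exp (9 * η) = 1 := by rw [← Real.exp_add]; simp
  have hnear' : NearFace η θ (faceVec x i s N) := by
    refine hnear.mono ?_
    have := mul_le_mul_of_nonneg_right h2 (Real.exp_pos (9 * η)).le
    nlinarith
  obtain ⟨h0, h1⟩ := H _ hnear' (by
    rw [htilt]
    have hc := h.faceVec_mem_cube hn i s 3
    refine le_trans ?_ (mul_exp_neg_abs_le_tilt hc d)
    have hji : 1 - i ≠ i := by fin_cases i <;> decide
    have e3 : faceVec x i s n 3 = x n (1 - i) (s + i) := by rw [h.faceVec_eq hn]; rfl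
    have hq : κ ≤ faceVec x i s n 3 := by rw [e3]; exact hopp _ hji _
    have hq' : κ ≤ 1 - faceVec x i s n 3 := by
      rw [e3]
      have hs := h.snd_eq (t := n) (by omega) (1 - i)
      have hk0 := hopp _ hji 0
      have hk1 := hopp _ hji 1
      generalize s + i = r
      fin_cases r <;> simp <;> linarith
    exact mul_le_mul (mul_le_mul hq hq' hκ.le (hκ.le.trans hq)) (Real.exp_le_exp.2 (by linarith))
      hE.le (mul_nonneg (hκ.le.trans hq) (hκ.le.trans hq')))
  exact h.tendsto_of_faceVec hN he i s h0 h1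

theorem exists_tendsto_some_player {η : ℝ} (hη : 0 < η) (i s : Fin 2) :
    ∃ δ > 0, ∀ x, IsOMWU η x → ∀ n : ℤ, 0 ≤ n → x n i s < δ →
      Tendsto (fun t : ℤ => x t i s) atTop (𝓝 0) ∨
        ∃ j, j ≠ i ∧ ∃ s', Tendsto (fun t : ℤ => x t j s') atTop (𝓝 0) := by
  have hE : 0 < Real.exp (-(9 * η)) := Real.exp_pos _
  obtain ⟨θ, hθ, H⟩ := exists_tendsto_boundary hη
  refine ⟨min (1 / 2) (θ * Real.exp (-(9 * η)) / 2), by positivity, ?_⟩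
  intro x h n hn hx
  have h2 := min_le_right (1 / 2) (θ * Real.exp (-(9 * η)) / 2)
  obtain ⟨N, hN, he, hnear, -⟩ := h.exists_nearFace hη hn i s
    (le_odds_of_lt (h.pos hn i s).le (min_le_left _ _) hx)
  have hee : Real.exp (-(9 * η)) * Real.exp (9 * η) = 1 := by rw [← Real.exp_add]; simp
  have hnear' : NearFace η θ (faceVec x i s N) := by
    refine hnear.mono ?_
    have := mul_le_mul_of_nonneg_right h2 (Real.exp_pos (9 * η)).le
    nlinarith
  rcases H _ hnear' with ⟨h0, h1⟩ | ⟨l, hl, h2, h3⟩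
  · exact Or.inl (h.tendsto_of_faceVec hN he i s h0 h1)
  · have hlim := h.tendsto_opponent_of_faceVec hN he i s h2 h3
    refine Or.inr ⟨1 - i, by fin_cases i <;> decide, ?_⟩
    rcases hl with rfl | rfl
    · exact ⟨_, hlim⟩
    -- If the tracked strategy of the opponent tends to `1`, the complementary one tends to `0`.
    · refine ⟨1 - (s + i), ?_⟩
      have h1 := hlim.const_sub 1
      rw [sub_self] at h1
      refine h1.congr' ?_
      filter_upwards [eventually_ge_atTop 0] with t ht
      have hs := h.snd_eq (t := t) (by omega) (1 - i)
      generalize s + i = r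
      fin_cases r <;> simp [hs]

end PeriodicOMWU

end

theorem mainTheorem4 (η : ℝ) (hη : 0 < η) :
    -- two steps of the dynamics, from an even time, are one application of `G₁ ∘ G₂`
    (∀ x, PeriodicOMWU.IsOMWU η x → ∀ n : ℤ, 0 ≤ n → Even n →
      PeriodicOMWU.iterVec x (n + 2) =
        (PeriodicOMWU.G₁ η ∘ PeriodicOMWU.G₂ η) (PeriodicOMWU.iterVec x n)) ∧
    -- on each of the four faces: player `i` does not use strategy `s`
    ∀ i s : Fin 2,
      -- every point of the family is fixed
      (∀ a ∈ Set.Icc (0 : ℝ) 1,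
        Function.IsFixedPt (PeriodicOMWU.G₁ η ∘ PeriodicOMWU.G₂ η)
          (PeriodicOMWU.facePoint η i s a)) ∧
      -- the Jacobian has the eigenvalues `0, 0, 1` and a value below `1`
      (∀ a ∈ Set.Ioo (0 : ℝ) 1,
        DifferentiableAt ℝ (PeriodicOMWU.G₁ η ∘ PeriodicOMWU.G₂ η)
          (PeriodicOMWU.facePoint η i s a) ∧
        (PeriodicOMWU.jacobian (PeriodicOMWU.G₁ η ∘ PeriodicOMWU.G₂ η)
          (PeriodicOMWU.facePoint η i s a)).charpoly =
            X ^ 2 * (X - 1) * (X - C (PeriodicOMWU.fourthEigenvalue η a)) ∧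
        0 < PeriodicOMWU.fourthEigenvalue η a ∧ PeriodicOMWU.fourthEigenvalue η a < 1) ∧
      -- an iterate vector near the face is near a point of the family
      (∀ ε > 0, ∃ δ > 0, ∀ x, PeriodicOMWU.IsOMWU η x → ∀ n : ℤ, 2 ≤ n → Even n →
        x (n - 1) i s < δ → x n i s < δ →
          ∃ a ∈ Set.Ioo (0 : ℝ) 1,
            dist (PeriodicOMWU.iterVec x n) (PeriodicOMWU.facePoint η i s a) < ε) ∧
      -- from a neighborhood of each point of the family, the two entries of player `i` tend to
      -- their values on the face
      (∀ a ∈ Set.Ioo (0 : ℝ) 1, ∃ ρ > 0, ∀ z : Fin 4 → ℝ, (∀ k, z k ∈ Set.Icc (0 : ℝ) 1) →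
        dist z (PeriodicOMWU.facePoint η i s a) < ρ → ∀ r : Fin 2,
          Tendsto
            (fun t : ℕ => ((PeriodicOMWU.G₁ η ∘ PeriodicOMWU.G₂ η)^[t] z) (PeriodicOMWU.coord i r))
            atTop (𝓝 (![0, 1] s))) ∧
      -- a trajectory that comes close to the face, the opponent being `κ`-far from the boundary,
      -- converges to the face, and the KL-divergence to the equilibrium tends to infinity
      (∀ κ > 0, ∃ δ > 0, ∀ x, PeriodicOMWU.IsOMWU η x → ∀ n : ℤ, 0 ≤ n →
        x (n - 1) i s < δ → x n i s < δ → (∀ j, j ≠ i → ∀ s', κ ≤ x n j s') →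
          Tendsto (fun t : ℤ => x t i s) atTop (𝓝 0) ∧
          Tendsto (fun t : ℤ => PeriodicOMWU.KL PeriodicOMWU.equilibrium (x t)) atTop atTop) ∧
      -- without any condition on the opponent, at least one of the players converges to the
      -- boundary, and the KL-divergence to the equilibrium tends to infinity
      (∃ δ > 0, ∀ x, PeriodicOMWU.IsOMWU η x → ∀ n : ℤ, 0 ≤ n →
        x (n - 1) i s < δ → x n i s < δ →
          (Tendsto (fun t : ℤ => x t i s) atTop (𝓝 0) ∨
            ∃ j, j ≠ i ∧ ∃ s', Tendsto (fun t : ℤ => x t j s') atTop (𝓝 0)) ∧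
          Tendsto (fun t : ℤ => PeriodicOMWU.KL PeriodicOMWU.equilibrium (x t)) atTop atTop) := by
  refine ⟨fun x h n hn he => h.iterVec_add_two hn he, fun i s => ⟨?_, ?_, ?_, ?_, ?_, ?_⟩⟩
  · exact fun a ha => PeriodicOMWU.isFixedPt_facePoint η i s ha
  · exact fun a ha => ⟨PeriodicOMWU.differentiableAt_twoStep η
      (PeriodicOMWU.facePoint_mem_cube η i s (Set.Ioo_subset_Icc_self ha)),
      PeriodicOMWU.charpoly_jacobian_facePoint η i s ha, Real.exp_pos _,
      PeriodicOMWU.fourthEigenvalue_lt_one hη ha⟩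
  · exact fun ε hε => PeriodicOMWU.exists_facePoint_near hη i s hε
  · exact fun a ha => PeriodicOMWU.exists_tendsto_near_facePoint hη i s ha
  · intro κ hκ
    obtain ⟨δ, hδ, H⟩ := PeriodicOMWU.exists_tendsto_of_opponent_interior hη i s hκ
    refine ⟨δ, hδ, fun x h n hn _ hx hopp => ?_⟩
    have h0 := H x h n hn hx hopp
    exact ⟨h0, h.tendsto_KL h0⟩
  · obtain ⟨δ, hδ, H⟩ := PeriodicOMWU.exists_tendsto_some_player hη i s
    refine ⟨δ, hδ, fun x h n hn _ hx => ?_⟩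
    have h0 := H x h n hn hx
    refine ⟨h0, ?_⟩
    rcases h0 with h0 | ⟨j, -, s', h0⟩
    · exact h.tendsto_KL h0
    · exact h.tendsto_KL h0
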